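/- Work over $\mathbb{C}$. For power series $f=(f_1,\dots,f_n)\in (t\,\mathbb{C}[[t]])^n$, the *value semigroup* of $f$ is the set of $t$-adic orders of the nonzero elements of the image of $\mathbb{C}[[x_1,\dots,x_n]]\to\mathbb{C}[[t]]$, $x_i\mapsto f_i$; and $f$ has *ramification profile* $(k_1,\dots,k_n)$, where $0<k_1<\dots<k_n$, if $\{0,k_1,\dots,k_n\}$ is the set of orders of nonzero $\mathbb{C}$-linear combinations of $1,f_1,\dots,f_n$. A set $S\subseteq\mathbb{N}$ is the *value semigroup of a generic cusp* with this profile if all $f$ in some nonempty Zariski open subset (defined by the nonvanishing of a polynomial in finitely many of the coefficients of the $f_i$) of the space of all $f$ with the profile have value semigroup $S$. Let $M^n_d\subset\mathbb{C}^{(n+1)(d+1)}$ be the space of nondegenerate morphisms $\mathbb{P}^1\to\mathbb{P}^n$ of degree $d$, each identified with the coefficients of its $n+1$ parameterizing binary forms of degree $d$ (which have no common zero and are linearly independent). For $S\subsetneq\mathbb{N}$ with $g=\#(\mathbb{N}\setminus S)$ finite, let $M^n_{d,g;S}\subseteq M^n_d$ be the Severi variety of those morphisms that normalize a curve (of arithmetic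 genus $g$) with exactly one singular point, that point being a cusp, i.e. unibranch, with value semigroup $S$. **Theorem.** There is a function $D:\mathbb{N}\to\mathbb{N}$ such that the following holds for all positive integers $n\ge 4$ and $m>\frac{7}{6}n+\frac{26}{9}$. There is exactly one value semigroup $S_{\rm gen}$ of a generic cusp with ramification profile $(2m,2m+2,\dots,2m+2n-2)$; its complement in $\mathbb{N}$ is finite, of cardinality $g$ say; and for every $d\ge D(g)$ the codimension of $M^n_{d,g;S_{\rm gen}}$ in $M^n_d$ is strictly less than $(n-2)g$ (in particular $M^n_{d,g;S_{\rm gen}}$ is nonempty, the empty set having codimension $\infty$). -/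

import Mathlib

noncomputable section

namespace SeveriGen

/-! ### Value semigroups and ramification profiles of parameterized cusps -/

/-- The value set `v_t(φ(R) \ {0})` of the germ parameterized by `f = (f₁, …, fₙ)`, where
`φ : R = ℂ⟦x₁, …, xₙ⟧ → ℂ⟦t⟧` sends `x_i` to `f_i`. It is used only for germs at the origin, that
is, when all the `f_i` have zero constant term, so that the substitution makes sense. -/
def valueSemigroup {n : ℕ} (f : Fin n → PowerSeries ℂ) : Set ℕ :=
  {s | ∃ G : MvPowerSeries (Fin n) ℂ,
    PowerSeries.order (MvPowerSeries.subst f G : PowerSeries ℂ) = (s : ℕ∞)}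

/-- The vanishing orders at `t = 0` of the (nonzero) linear combinations of `1, f₁, …, fₙ`. -/
def vanishingOrders {n : ℕ} (f : Fin n → PowerSeries ℂ) : Set ℕ :=
  {s | ∃ (c₀ : ℂ) (c : Fin n → ℂ),
    PowerSeries.order (PowerSeries.C c₀ + ∑ i, c i • f i) = (s : ℕ∞)}

/-- `f` parameterizes a germ at the origin of `ℂⁿ` with ramification profile `k = (k₁, …, kₙ)`
(and `k₀ = 0`). -/
def HasRamificationProfile {n : ℕ} (f : Fin n → PowerSeries ℂ) (k : Fin n → ℕ) : Prop :=
  (∀ i, PowerSeries.constantCoeff (f i) = 0) ∧ vanishingOrders f = insert 0 (Set.range k)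

/-- The value at `f` of a polynomial `Q` in (finitely many of) the coefficients of an `n`-tuple of
power series; the variable `(i, j)` stands for the coefficient of `t ^ j` in `f_i`. -/
def evalCoeffs {n : ℕ} (Q : MvPolynomial (Fin n × ℕ) ℂ) (f : Fin n → PowerSeries ℂ) : ℂ :=
  MvPolynomial.eval (fun ij : Fin n × ℕ => PowerSeries.coeff ij.2 (f ij.1)) Q

/-- `S` is the value semigroup of a generic cusp with ramification profile `k`: all members of some
nonempty (basic) Zariski open subset of the space of germs with ramification profile `k` have value
semigroup `S`. -/
def IsGenericValueSemigroup {n : ℕ} (k : Fin n → ℕ) (S : Set ℕ) : Prop :=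
  ∃ Q : MvPolynomial (Fin n × ℕ) ℂ,
    (∃ f, HasRamificationProfile f k ∧ evalCoeffs Q f ≠ 0) ∧
    ∀ f, HasRamificationProfile f k → evalCoeffs Q f ≠ 0 → valueSemigroup f = S

/-- The profile `(2m, 2m + 2, …, 2m + 2n - 2)`. -/
def evenProfile (n m : ℕ) : Fin n → ℕ := fun i => 2 * m + 2 * (i : ℕ)

/-! ### Morphisms from the projective line to projective space -/

/-- Coefficients of `n + 1` binary forms of degree `d`. -/
abbrev Coeffs (n d : ℕ) : Type := Fin (n + 1) × Fin (d + 1) → ℂ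

/-- The forms `F_i(x, y) = ∑ j, a_{i,j} x ^ j y ^ (d - j)`, evaluated at `u = (x, y)` in a
`ℂ`-algebra. -/
def formEval {n d : ℕ} {A : Type} [CommRing A] [Algebra ℂ A] (a : Coeffs n d) (u : Fin 2 → A) :
    Fin (n + 1) → A :=
  fun i => ∑ j : Fin (d + 1), a (i, j) • (u 0 ^ (j : ℕ) * u 1 ^ (d - (j : ℕ)))

theorem formEval_smul {n d : ℕ} (a : Coeffs n d) (t : ℂ) (u : Fin 2 → ℂ) :
    formEval a (t • u) = t ^ d • formEval a u := by
  funext i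
  simp only [formEval, Pi.smul_apply, smul_eq_mul, Finset.mul_sum]
  refine Finset.sum_congr rfl fun j _ => ?_
  have h : t ^ d = t ^ (j : ℕ) * t ^ (d - (j : ℕ)) := by
    rw [← pow_add, Nat.add_sub_cancel' (Nat.lt_succ_iff.mp j.2)]
  rw [h, mul_pow, mul_pow]
  ring

/-- The forms have no common zero on the projective line. -/
def BasePointFree {n d : ℕ} (a : Coeffs n d) : Prop :=
  ∀ u : Fin 2 → ℂ, u ≠ 0 → formEval a u ≠ 0

/-- The space `M^n_d` of nondegenerate morphisms `ℙ¹ → ℙⁿ` of degree `d`, inside the affine space of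
coefficients: the forms have no common zero and are linearly independent (so that the image lies in
no hyperplane). -/
def morphismSpace (n d : ℕ) : Set (Coeffs n d) :=
  {a | BasePointFree a ∧ LinearIndependent ℂ (fun i j => a (i, j))}

/-- The map `ℙ¹ → ℙⁿ` defined by base point free forms. -/
def toProjMap {n d : ℕ} (a : Coeffs n d) (ha : BasePointFree a) :
    Projectivization ℂ (Fin 2 → ℂ) → Projectivization ℂ (Fin (n + 1) → ℂ) :=
  Projectivization.lift
    (fun u => Projectivization.mk ℂ (formEval a (u : Fin 2 → ℂ)) (ha u.1 u.2))
    (by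
      rintro ⟨u, hu⟩ ⟨v, hv⟩ t (rfl : u = t • v)
      exact (Projectivization.mk_eq_mk_iff' ℂ _ _ _ _).2 ⟨t ^ d, (formEval_smul a t v).symm⟩)

/-- The power series `F_i(u + t w)`: the homogeneous coordinates of the morphism near the point
`[u]`, in the local parameter `t` given by a direction `w` independent of `u`. -/
def expansion {n d : ℕ} (a : Coeffs n d) (u w : Fin 2 → ℂ) : Fin (n + 1) → PowerSeries ℂ :=
  formEval a (fun l => PowerSeries.C (u l) + w l • PowerSeries.X)

/-- The affine coordinates `F_i / F_j`, `i ≠ j`, centered at the image point. Meaningful when `F_j`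
has nonzero constant term. -/
def affineGerm {n : ℕ} (F : Fin (n + 1) → PowerSeries ℂ) (j : Fin (n + 1)) :
    Fin n → PowerSeries ℂ :=
  fun i => F (j.succAbove i) * (F j)⁻¹ -
    PowerSeries.C (PowerSeries.constantCoeff (F (j.succAbove i) * (F j)⁻¹))

/-- The branch of the morphism at `p ∈ ℙ¹` has value semigroup `S`, computed in a local parameter
at `p` and an affine chart around the image of `p` (the choices do not affect the semigroup). -/
def HasValueSemigroupAt {n d : ℕ} (a : Coeffs n d) (p : Projectivization ℂ (Fin 2 → ℂ))
    (S : Set ℕ) : Prop :=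
  ∃ (u w : Fin 2 → ℂ) (hu : u ≠ 0) (j : Fin (n + 1)),
    Projectivization.mk ℂ u hu = p ∧ LinearIndependent ℂ ![u, w] ∧ formEval a u j ≠ 0 ∧
    valueSemigroup (affineGerm (expansion a u w) j) = S

/-- The Severi variety `M^n_{d,g;S}`, `g = #(ℕ \ S)`: nondegenerate morphisms `ℙ¹ → ℙⁿ` of degree
`d` that normalize a curve with exactly one singular point, this point being a cusp (unibranch) with
value semigroup `S`. That is, the morphism is injective, its branch at some point `p` has value
semigroup `S ≠ ℕ`, and every other branch has value semigroup `ℕ` (is smooth). The arithmetic genus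
of the image is the delta-invariant `#(ℕ \ S)` of the cusp. -/
def severiVariety (n d : ℕ) (S : Set ℕ) : Set (Coeffs n d) :=
  {a | a ∈ morphismSpace n d ∧ S ≠ Set.univ ∧
    ∃ ha : BasePointFree a, Function.Injective (toProjMap a ha) ∧
      ∃ p, HasValueSemigroupAt a p S ∧ ∀ q, q ≠ p → HasValueSemigroupAt a q Set.univ}

/-! ### Codimension -/

/-- The codimension of `Y` in `X`, for subsets `Y ⊆ X` of an affine space: the codimension of the
Zariski closure of `Y` in that of `X`, i.e. the height of the ideal of `Y` in the coordinate ring of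
the closure of `X`. The codimension of the empty set is `⊤`. -/
def codimension {σ : Type} (X Y : Set (σ → ℂ)) : ℕ∞ :=
  ((MvPolynomial.vanishingIdeal ℂ Y).map
    (Ideal.Quotient.mk (MvPolynomial.vanishingIdeal ℂ X))).height

end SeveriGen

end

/-!
Germs with ramification profile `k` are parameterized by a nonempty open subset of an affine space,
and for every `N` the number of elements below `N` of their value semigroup is lower semicontinuous.
One germ whose semigroup has finitely many gaps bounds the gaps of all the nearby ones, so that a
generic germ has a single value semigroup. For the even profile such a germ is found by perturbing
monomials until their products produce an odd order.

Near a given point, the forms of degree `d` whose vanishing orders at `[0 : 1]` are `0` and the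
`k i` are cut out by `∑ (k i - (i + 1))` equations: the coefficients, apart from those in the pivot
columns, that a fraction-free row reduction has to make vanish. They involve only coefficients of
low degree. If the other coefficients are algebraically independent over a field containing the low
ones, the morphism is an embedding away from `[0 : 1]`: a double point or a ramification point
depends on at most three parameters and would give `n + 1 ≥ 4` relations between independent
transcendentals. Such forms are dense among the solutions of the equations, so Krull's height
theorem bounds the codimension of the Severi variety by `∑ (k i - (i + 1))`.

On the other hand the number `g` of gaps is large, because modulo `t ^ N` the ring generated by a
germ with profile `(2m, 2m + 2, …)` is spanned by few monomials: those of degree at most `1` for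
`N = 4m`, and those of degree at most `2` together with one cube for `N = 6m + 2`. The two lower
bounds for `g` give `∑ (k i - (i + 1)) < (n - 2) g`.
-/

namespace SeveriGen

section Orders

open PowerSeries Module

variable {𝕜 : Type*} [Field 𝕜]

theorem exists_order_sum_smul_eq {ι : Type*} {h : ι → 𝕜⟦X⟧} {k : ι → ℕ}
    (hk : Function.Injective k) (ho : ∀ i, order (h i) = (k i : ℕ∞)) {s : Finset ι} {c : ι → 𝕜}
    (hc : ∃ i ∈ s, c i ≠ 0) : ∃ i ∈ s, order (∑ i ∈ s, c i • h i) = (k i : ℕ∞) := by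
  classical
  obtain ⟨i₀, his₀, hi₀⟩ := hc
  obtain ⟨i, hi, hmin⟩ := Finset.exists_min_image (s.filter fun i => c i ≠ 0) k
    ⟨i₀, Finset.mem_filter.2 ⟨his₀, hi₀⟩⟩
  simp only [Finset.mem_filter] at hi hmin
  have hlow (b : ι) (hb : b ∈ s) (j : ℕ) (hj : j < k i ∨ j = k i ∧ b ≠ i) :
      coeff j (c b • h b) = 0 := by
    by_cases hcb : c b = 0
    · simp [hcb]
    · have hle := hmin b ⟨hb, hcb⟩
      have hlt : j < k b := by
        rcases hj with hj | ⟨rfl, hbi⟩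
        · exact hj.trans_le hle
        · exact hle.lt_of_ne fun e => hbi (hk e.symm)
      simp [(order_eq_nat.1 (ho b)).2 _ hlt]
  refine ⟨i, hi.1, order_eq_nat.2 ⟨?_, fun j hj => ?_⟩⟩
  · rw [map_sum, Finset.sum_eq_single_of_mem i hi.1 fun b hb hbi => hlow b hb _ (.inr ⟨rfl, hbi⟩)]
    simpa using ⟨hi.2, (order_eq_nat.1 (ho i)).1⟩
  · rw [map_sum]
    exact Finset.sum_eq_zero fun b hb => hlow b hb j (.inl hj)

theorem linearIndependent_of_order {ι : Type*} {h : ι → 𝕜⟦X⟧} {k : ι → ℕ}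
    (hk : Function.Injective k) (ho : ∀ i, order (h i) = (k i : ℕ∞)) :
    LinearIndependent 𝕜 h := by
  rw [linearIndependent_iff']
  intro s c hc i hi
  by_contra hne
  obtain ⟨j, -, hj⟩ := exists_order_sum_smul_eq hk ho ⟨i, hi, hne⟩
  simp [hc] at hj

theorem X_pow_dvd_of_order_eq {w : 𝕜⟦X⟧} {N s : ℕ}
    (hw : order w = (s : ℕ∞)) (hN : N ≤ s) : X ^ N ∣ w :=
  X_pow_dvd_iff.2 fun j hj => (order_eq_nat.1 hw).2 j (hj.trans_le hN)

theorem order_eq_of_X_pow_dvd_sub {v w : 𝕜⟦X⟧} {s : ℕ} (h : X ^ (s + 1) ∣ v - w)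
    (hw : order w = (s : ℕ∞)) : order v = (s : ℕ∞) := by
  have hcoeff (j : ℕ) (hj : j < s + 1) : coeff j v = coeff j w := by
    simpa [sub_eq_zero] using X_pow_dvd_iff.1 h j hj
  rw [order_eq_nat] at hw ⊢
  exact ⟨hcoeff s s.lt_succ_self ▸ hw.1, fun j hj => hcoeff j (by omega) ▸ hw.2 j hj⟩

/-- The orders of the nonzero elements of a space of power series. -/
def orderSet (W : Submodule 𝕜 𝕜⟦X⟧) : Set ℕ :=
  {s | ∃ w ∈ W, order w = (s : ℕ∞)}

theorem orderSet_span_range {ι : Type*} {h : ι → 𝕜⟦X⟧} {k : ι → ℕ}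
    (hk : Function.Injective k) (ho : ∀ i, order (h i) = (k i : ℕ∞)) :
    orderSet (Submodule.span 𝕜 (Set.range h)) = Set.range k := by
  refine Set.Subset.antisymm ?_ (Set.range_subset_iff.2 fun i =>
    ⟨h i, Submodule.subset_span ⟨i, rfl⟩, ho i⟩)
  rintro s ⟨w, hw, hs⟩
  obtain ⟨c, rfl⟩ := Finsupp.mem_span_range_iff_exists_finsupp.1 hw
  have hc : c ≠ 0 := by
    rintro rfl
    simp at hs
  obtain ⟨i, hi⟩ := Finsupp.support_nonempty_iff.2 hc
  obtain ⟨j, -, hj⟩ := exists_order_sum_smul_eq hk ho ⟨i, hi, Finsupp.mem_support_iff.1 hi⟩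
  exact ⟨j, by exact_mod_cast hj.symm.trans hs⟩

/-- The first `N` coefficients of a power series. -/
noncomputable def jet (N : ℕ) : 𝕜⟦X⟧ →ₗ[𝕜] (Fin N → 𝕜) :=
  LinearMap.pi fun j => coeff (j : ℕ)

@[simp]
theorem jet_apply (N : ℕ) (w : 𝕜⟦X⟧) (j : Fin N) : jet N w j = coeff (j : ℕ) w :=
  rfl

theorem jet_eq_jet_iff {N : ℕ} {v w : 𝕜⟦X⟧} : jet N v = jet N w ↔ X ^ N ∣ v - w := by
  rw [X_pow_dvd_iff]
  simp only [funext_iff, jet_apply, map_sub, sub_eq_zero, Fin.forall_iff]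

theorem linearIndependent_jet_of_order {ι : Type*} {h : ι → 𝕜⟦X⟧} {k : ι → ℕ} {N : ℕ}
    (hk : Function.Injective k) (ho : ∀ i, order (h i) = (k i : ℕ∞)) (hN : ∀ i, k i < N) :
    LinearIndependent 𝕜 fun i => jet N (h i) := by
  rw [linearIndependent_iff']
  intro s c hc i hi
  by_contra hne
  obtain ⟨j, -, hj⟩ := exists_order_sum_smul_eq hk ho ⟨i, hi, hne⟩
  have hcoeff := congrFun hc ⟨k j, hN j⟩
  simp only [← map_smul, ← map_sum] at hcoeff
  exact (order_eq_nat.1 hj).1 hcoeff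

theorem eq_zero_of_mem_map_jet {W : Submodule 𝕜 𝕜⟦X⟧} {N : ℕ} {v : Fin N → 𝕜}
    (hv : v ∈ W.map (jet N)) (h : ∀ j : Fin N, (j : ℕ) ∈ orderSet W → v j = 0) : v = 0 := by
  obtain ⟨w, hw, rfl⟩ := hv
  by_contra hne
  obtain ⟨j, hj⟩ := Function.ne_iff.1 hne
  have hlt : order w < N := (order_le _ hj).trans_lt (by exact_mod_cast j.2)
  lift order w to ℕ using hlt.ne_top with s hs
  exact (order_eq_nat.1 hs.symm).1 (h ⟨s, by exact_mod_cast hlt⟩ ⟨w, hw, hs.symm⟩)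

open Classical in
theorem count_orderSet (W : Submodule 𝕜 𝕜⟦X⟧) (N : ℕ) :
    Nat.count (· ∈ orderSet W) N = finrank 𝕜 (W.map (jet N)) := by
  let _ := Nat.CountSet.fintype (· ∈ orderSet W) N
  rw [Nat.count_eq_card_fintype]
  refine le_antisymm ?_ ?_
  · choose w hw ho using fun s : {s // s < N ∧ s ∈ orderSet W} => s.2.2
    have hli := linearIndependent_jet_of_order Subtype.val_injective ho fun s => s.2.1
    rw [← finrank_span_eq_card hli]
    exact Submodule.finrank_mono (Submodule.span_le.2 (Set.range_subset_iff.2 fun s =>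
      Submodule.mem_map_of_mem (hw s)))
  · let π : (Fin N → 𝕜) →ₗ[𝕜] ({s // s < N ∧ s ∈ orderSet W} → 𝕜) :=
      LinearMap.funLeft 𝕜 𝕜 fun s => ⟨s, s.2.1⟩
    have hπ : Function.Injective (π.domRestrict (W.map (jet N))) := by
      refine (injective_iff_map_eq_zero _).2 fun v hv => Subtype.ext ?_
      exact eq_zero_of_mem_map_jet v.2 fun j hj => congrFun hv ⟨j, j.2, hj⟩
    simpa using LinearMap.finrank_le_finrank_of_injective hπ

end Orders

section Matrices

variable {R M ι κ : Type*} [CommRing R] [AddCommGroup M] [Module R M] [Fintype κ]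

theorem sum_smul_sum_smul {μ : Type*} [Fintype μ] (A : Matrix ι κ R) (B : Matrix κ μ R)
    (h : μ → M) (i : ι) : ∑ j, A i j • ∑ l, B j l • h l = ∑ l, (A * B) i l • h l := by
  simp only [Finset.smul_sum, smul_smul, Matrix.mul_apply, Finset.sum_smul]
  exact Finset.sum_comm

variable [DecidableEq κ] {A : Matrix κ κ R}

theorem sum_inv_smul_sum_smul (hA : IsUnit A.det) (h : κ → M) (i : κ) :
    ∑ j, A⁻¹ i j • ∑ l, A j l • h l = h i := by
  simp [sum_smul_sum_smul, Matrix.nonsing_inv_mul A hA, Matrix.one_apply]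

theorem span_range_sum_smul_eq (hA : IsUnit A.det) (h : κ → M) :
    Submodule.span R (Set.range fun i => ∑ j, A i j • h j) = Submodule.span R (Set.range h) := by
  refine le_antisymm ?_ ?_ <;> refine Submodule.span_le.2 (Set.range_subset_iff.2 fun i => ?_)
  · exact Submodule.sum_smul_mem _ _ fun j _ => Submodule.subset_span ⟨j, rfl⟩
  · rw [← sum_inv_smul_sum_smul hA h i]
    exact Submodule.sum_smul_mem _ _ fun j _ => Submodule.subset_span ⟨j, rfl⟩

theorem det_ne_zero_of_linearIndependent_sum_smul {𝕜 V : Type*} [Field 𝕜] [AddCommGroup V]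
    [Module 𝕜 V] {A : Matrix κ κ 𝕜} {h : κ → V}
    (hli : LinearIndependent 𝕜 fun i => ∑ j, A i j • h j) : A.det ≠ 0 := by
  have hrow : LinearIndependent 𝕜 A.row :=
    LinearIndependent.of_comp (Fintype.linearCombination 𝕜 h) hli
  exact ((Matrix.isUnit_iff_isUnit_det A).1
    (Matrix.linearIndependent_rows_iff_isUnit.1 hrow)).ne_zero

end Matrices

section Gaps

open PowerSeries Module

theorem finite_compl_of_setGcd_eq_one {S : AddSubmonoid ℕ} (h : Nat.setGcd S = 1) :
    (S : Set ℕ)ᶜ.Finite := by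
  obtain ⟨N, hN⟩ := Nat.exists_mem_closure_of_ge (S : Set ℕ)
  refine (Set.finite_Iio N).subset fun m hm => ?_
  contrapose! hm
  simpa [AddSubmonoid.closure_eq] using hN m (by simpa using hm) (by simp [h])

open Classical in
theorem le_count_add_ncard_compl {S : Set ℕ} (hS : Sᶜ.Finite) (N : ℕ) :
    N ≤ Nat.count (· ∈ S) N + Sᶜ.ncard := by
  have hgaps : ((Finset.range N).filter (· ∉ S)).card ≤ Sᶜ.ncard := by
    rw [← Set.ncard_coe_finset]
    exact Set.ncard_le_ncard (fun x hx => (Finset.mem_filter.1 hx).2) hS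
  have hsplit := Finset.card_filter_add_card_filter_not (s := Finset.range N) (· ∈ S)
  rw [Finset.card_range] at hsplit
  rw [Nat.count_eq_card_filter_range]
  omega

variable {𝕜 : Type*} [Field 𝕜]

/-- The additive monoid of orders of nonzero elements of a ring of power series. -/
def orderMonoid (A : Subalgebra 𝕜 𝕜⟦X⟧) : AddSubmonoid ℕ where
  carrier := orderSet A.toSubmodule
  zero_mem' := ⟨1, A.one_mem, by simp⟩
  add_mem' := by
    rintro s t ⟨v, hv, hs⟩ ⟨w, hw, ht⟩
    exact ⟨v * w, A.mul_mem hv hw, by rw [order_mul, hs, ht, Nat.cast_add]⟩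

theorem coe_orderMonoid (A : Subalgebra 𝕜 𝕜⟦X⟧) :
    (orderMonoid A : Set ℕ) = orderSet A.toSubmodule :=
  rfl

theorem mem_orderMonoid {A : Subalgebra 𝕜 𝕜⟦X⟧} {s : ℕ} :
    s ∈ orderMonoid A ↔ ∃ w ∈ A, order w = (s : ℕ∞) :=
  Iff.rfl

theorem pow_card_dvd_prod {M : Type*} [CommMonoid M] {x : M} {s : Multiset M}
    (h : ∀ y ∈ s, x ∣ y) : x ^ s.card ∣ s.prod := by
  induction s using Multiset.induction with
  | empty => simp
  | cons y s ih =>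
    rw [Multiset.card_cons, Multiset.prod_cons, pow_succ']
    exact mul_dvd_mul (h y (s.mem_cons_self y)) (ih fun z hz => h z (Multiset.mem_cons_of_mem hz))

variable {ι : Type*} {f : ι → 𝕜⟦X⟧}

theorem X_pow_dvd_prod_map {q N : ℕ} (h : ∀ i, X ^ q ∣ f i) {s : Multiset ι}
    (hN : N ≤ q * s.card) : X ^ N ∣ (s.map f).prod := by
  refine (pow_dvd_pow X hN).trans ?_
  rw [pow_mul, ← s.card_map f]
  exact pow_card_dvd_prod fun y hy => by
    obtain ⟨i, -, rfl⟩ := Multiset.mem_map.1 hy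
    exact h i

theorem le_ncard_compl_orderMonoid_adjoin_add {κ : Type*} [Fintype κ] {v : κ → 𝕜⟦X⟧} {N : ℕ}
    (hv : ∀ s : Multiset ι,
      ∃ w ∈ Submodule.span 𝕜 (Set.range v), X ^ N ∣ (s.map f).prod - w)
    (hfin : (orderMonoid (Algebra.adjoin 𝕜 (Set.range f)) : Set ℕ)ᶜ.Finite) :
    N ≤ (orderMonoid (Algebra.adjoin 𝕜 (Set.range f)) : Set ℕ)ᶜ.ncard + Fintype.card κ := by
  have hle : (Algebra.adjoin 𝕜 (Set.range f)).toSubmodule.map (jet N) ≤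
      (Submodule.span 𝕜 (Set.range v)).map (jet N) := by
    rw [Algebra.adjoin_eq_span, Submodule.map_span_le]
    intro y hy
    obtain ⟨s, hs, rfl⟩ := Submonoid.exists_multiset_of_mem_closure hy
    have : CanLift 𝕜⟦X⟧ ι f (· ∈ Set.range f) := ⟨fun _ h => h⟩
    lift s to Multiset ι using hs
    obtain ⟨w, hw, hN⟩ := hv s
    exact jet_eq_jet_iff.2 hN ▸ Submodule.mem_map_of_mem hw
  have hcard : finrank 𝕜 ((Submodule.span 𝕜 (Set.range v)).map (jet N)) ≤ Fintype.card κ := by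
    rw [Submodule.map_span, ← Set.range_comp]
    exact finrank_range_le_card _
  have hcount := le_count_add_ncard_compl hfin N
  rw [coe_orderMonoid, count_orderSet] at *
  have hmono := Submodule.finrank_mono hle
  omega

variable [Fintype ι]

theorem two_mul_le_ncard_compl_orderMonoid_adjoin_add {q : ℕ} (hf : ∀ i, X ^ q ∣ f i)
    (hfin : (orderMonoid (Algebra.adjoin 𝕜 (Set.range f)) : Set ℕ)ᶜ.Finite) :
    2 * q ≤ (orderMonoid (Algebra.adjoin 𝕜 (Set.range f)) : Set ℕ)ᶜ.ncard +
      (Fintype.card ι + 1) := by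
  rw [← Fintype.card_option]
  refine le_ncard_compl_orderMonoid_adjoin_add (v := fun i : Option ι => i.elim 1 f)
    (fun s => ?_) hfin
  have hmem (i : Option ι) : i.elim 1 f ∈ Submodule.span 𝕜 (Set.range fun i => Option.elim i 1 f) :=
    Submodule.subset_span ⟨i, rfl⟩
  obtain hs | hs | hs : s.card = 0 ∨ s.card = 1 ∨ 2 ≤ s.card := by omega
  · exact ⟨1, hmem none, by simp [Multiset.card_eq_zero.1 hs]⟩
  · obtain ⟨i, rfl⟩ := Multiset.card_eq_one.1 hs
    exact ⟨f i, hmem (some i), by simp⟩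
  · refine ⟨0, zero_mem _, ?_⟩
    rw [sub_zero]
    exact X_pow_dvd_prod_map hf (by nlinarith)

-- Modulo `t ^ (3 * q + e)` the products of at least three of the series vanish, except `f i₀ ^ 3`.
theorem three_mul_add_le_ncard_compl_orderMonoid_adjoin_add {q e : ℕ} {i₀ : ι}
    (h₀ : X ^ q ∣ f i₀) (hf : ∀ i ≠ i₀, X ^ (q + e) ∣ f i) (he : e ≤ q)
    (hfin : (orderMonoid (Algebra.adjoin 𝕜 (Set.range f)) : Set ℕ)ᶜ.Finite) :
    3 * q + e ≤ (orderMonoid (Algebra.adjoin 𝕜 (Set.range f)) : Set ℕ)ᶜ.ncard +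
      ((Fintype.card ι + 2).choose 2 + 1) := by
  classical
  let v : Option (Sym2 (Option ι)) → 𝕜⟦X⟧ := fun z =>
    z.elim (f i₀ ^ 3) fun y => (y.map fun i => i.elim 1 f).mul
  have hcard : Fintype.card (Option (Sym2 (Option ι))) = (Fintype.card ι + 2).choose 2 + 1 := by
    rw [Fintype.card_option, Sym2.card, Fintype.card_option]
  have hq (i : ι) : X ^ q ∣ f i := by
    by_cases hi : i = i₀
    · exact hi ▸ h₀
    · exact (pow_dvd_pow X (q.le_add_right e)).trans (hf i hi)
  have hmem (z) : v z ∈ Submodule.span 𝕜 (Set.range v) := Submodule.subset_span ⟨z, rfl⟩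
  rw [← hcard]
  refine le_ncard_compl_orderMonoid_adjoin_add (v := v) (fun s => ?_) hfin
  obtain hs | hs | hs | hs | hs : s.card = 0 ∨ s.card = 1 ∨ s.card = 2 ∨ s.card = 3 ∨
    4 ≤ s.card := by omega
  · exact ⟨_, hmem (some s(none, none)), by simp [v, Multiset.card_eq_zero.1 hs]⟩
  · obtain ⟨i, rfl⟩ := Multiset.card_eq_one.1 hs
    exact ⟨_, hmem (some s(some i, none)), by simp [v]⟩
  · obtain ⟨i, j, rfl⟩ := Multiset.card_eq_two.1 hs
    exact ⟨_, hmem (some s(some i, some j)), by simp [v]⟩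
  · by_cases hall : ∀ i ∈ s, i = i₀
    · refine ⟨_, hmem none, ?_⟩
      simp [v, Multiset.eq_replicate.2 ⟨hs, hall⟩, pow_three]
    · refine ⟨0, zero_mem _, ?_⟩
      push Not at hall
      obtain ⟨i, his, hi⟩ := hall
      obtain ⟨s, rfl⟩ := Multiset.exists_cons_of_mem his
      rw [sub_zero, Multiset.map_cons, Multiset.prod_cons,
        show 3 * q + e = (q + e) + q * s.card by rw [Multiset.card_cons] at hs; lia, pow_add X]
      exact mul_dvd_mul (hf i hi) (X_pow_dvd_prod_map hq le_rfl)
  · refine ⟨0, zero_mem _, ?_⟩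
    rw [sub_zero]
    exact X_pow_dvd_prod_map hq (by nlinarith)

end Gaps

section ValueSemigroup

open PowerSeries

variable {n : ℕ} {f : Fin n → ℂ⟦X⟧}

theorem X_pow_dvd_subst_sub_aeval_truncTotal (hf : ∀ i, constantCoeff (f i) = 0)
    (G : MvPowerSeries (Fin n) ℂ) (N : ℕ) :
    X ^ N ∣ (MvPowerSeries.subst f G : ℂ⟦X⟧) - MvPolynomial.aeval f (G.truncTotal N) := by
  have hs : MvPowerSeries.HasSubst f := MvPowerSeries.hasSubst_of_constantCoeff_zero hf
  have hsub : (MvPowerSeries.subst f G : ℂ⟦X⟧) - MvPolynomial.aeval f (G.truncTotal N) =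
      MvPowerSeries.subst f (G - (G.truncTotal N : MvPowerSeries (Fin n) ℂ)) := by
    rw [← MvPowerSeries.coe_substAlgHom hs, map_sub, MvPowerSeries.coe_substAlgHom hs]
    congr 1
    exact (MvPowerSeries.subst_coe _).symm
  have horder : (N : ℕ∞) ≤ (G - (G.truncTotal N : MvPowerSeries (Fin n) ℂ)).order :=
    MvPowerSeries.nat_le_order fun e he => by
      rw [map_sub, MvPolynomial.coeff_coe, MvPowerSeries.coeff_truncTotal _ he, sub_self]
  have hone : 1 ≤ ⨅ i, MvPowerSeries.order (f i) := le_iInf fun i =>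
    MvPowerSeries.one_le_order_iff_constCoeff_eq_zero.2 (hf i)
  rw [X_pow_dvd_iff, hsub]
  intro j hj
  refine coeff_of_lt_order _ ?_
  rw [order_eq_order]
  calc (j : ℕ∞) < N := by exact_mod_cast hj
    _ ≤ 1 * (G - (G.truncTotal N : MvPowerSeries (Fin n) ℂ)).order := by rwa [one_mul]
    _ ≤ _ := (mul_le_mul_left hone _).trans (MvPowerSeries.le_order_subst hs _)

theorem valueSemigroup_eq_orderMonoid (hf : ∀ i, constantCoeff (f i) = 0) :
    valueSemigroup f = orderMonoid (Algebra.adjoin ℂ (Set.range f)) := by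
  ext s
  rw [Algebra.adjoin_range_eq_range_aeval]
  constructor
  · rintro ⟨G, hG⟩
    refine ⟨_, ⟨G.truncTotal (s + 1), rfl⟩, order_eq_of_X_pow_dvd_sub ?_ hG⟩
    rw [dvd_sub_comm]
    exact X_pow_dvd_subst_sub_aeval_truncTotal hf G (s + 1)
  · rintro ⟨_, ⟨P, rfl⟩, hP⟩
    exact ⟨P, by rw [MvPowerSeries.subst_coe]; exact hP⟩

theorem mem_valueSemigroup_iff (hf : ∀ i, constantCoeff (f i) = 0) {s : ℕ} :
    s ∈ valueSemigroup f ↔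
      ∃ P : MvPolynomial (Fin n) ℂ, order (MvPolynomial.aeval f P) = (s : ℕ∞) := by
  rw [valueSemigroup_eq_orderMonoid hf, SetLike.mem_coe, mem_orderMonoid,
    Algebra.adjoin_range_eq_range_aeval]
  exact ⟨fun ⟨_, ⟨P, hP⟩, hs⟩ => ⟨P, hP ▸ hs⟩, fun ⟨P, hP⟩ => ⟨_, ⟨P, rfl⟩, hP⟩⟩

end ValueSemigroup

section Profiles

open PowerSeries

variable {n : ℕ}

theorem vanishingOrders_eq_orderSet (f : Fin n → ℂ⟦X⟧) :
    vanishingOrders f = orderSet (Submodule.span ℂ (insert 1 (Set.range f))) := by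
  ext s
  simp only [vanishingOrders, orderSet, Set.mem_ofPred_eq, Submodule.mem_span_insert,
    Submodule.mem_span_range_iff_exists_fun]
  constructor
  · rintro ⟨c₀, c, h⟩
    exact ⟨_, ⟨c₀, _, ⟨c, rfl⟩, rfl⟩, by rwa [smul_eq_C_mul, mul_one]⟩
  · rintro ⟨_, ⟨c₀, _, ⟨c, rfl⟩, rfl⟩, h⟩
    exact ⟨c₀, c, by rwa [smul_eq_C_mul, mul_one] at h⟩

variable {f : Fin n → ℂ⟦X⟧} {k : Fin n → ℕ}

theorem cons_zero_injective (hk : Function.Injective k) (hpos : ∀ i, 0 < k i) :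
    Function.Injective (Fin.cons 0 k : Fin (n + 1) → ℕ) :=
  Fin.cons_injective_iff.2 ⟨fun ⟨i, hi⟩ => (hpos i).ne' hi, hk⟩

theorem constantCoeff_eq_zero_of_order {w : ℂ⟦X⟧} {s : ℕ} (hs : 0 < s)
    (hw : order w = (s : ℕ∞)) : constantCoeff w = 0 := by
  simpa using (order_eq_nat.1 hw).2 0 hs

theorem hasRamificationProfile_of_order (hk : Function.Injective k) (hpos : ∀ i, 0 < k i)
    (ho : ∀ i, order (f i) = (k i : ℕ∞)) : HasRamificationProfile f k := by
  refine ⟨fun i => constantCoeff_eq_zero_of_order (hpos i) (ho i), ?_⟩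
  rw [vanishingOrders_eq_orderSet, ← Fin.range_cons, ← Fin.range_cons]
  refine orderSet_span_range (cons_zero_injective hk hpos) (Fin.cases ?_ fun i => ?_)
  · simp
  · simpa using ho i

theorem HasRamificationProfile.sum_smul (hf : HasRamificationProfile f k)
    {A : Matrix (Fin n) (Fin n) ℂ} (hA : A.det ≠ 0) :
    HasRamificationProfile (fun i => ∑ j, A i j • f j) k := by
  refine ⟨fun i => ?_, ?_⟩
  · simp only [map_sum, constantCoeff_smul, hf.1, smul_zero, Finset.sum_const_zero]
  · rw [← hf.2, vanishingOrders_eq_orderSet, vanishingOrders_eq_orderSet, Submodule.span_insert,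
      span_range_sum_smul_eq hA.isUnit, ← Submodule.span_insert]

theorem HasRamificationProfile.exists_order_eq (hf : HasRamificationProfile f k)
    (hk : Function.Injective k) (hpos : ∀ i, 0 < k i) :
    ∃ (h : Fin n → ℂ⟦X⟧) (A : Matrix (Fin n) (Fin n) ℂ), A.det ≠ 0 ∧
      (∀ i, order (h i) = (k i : ℕ∞)) ∧ f = fun i => ∑ j, A i j • h j := by
  have hex (i : Fin n) : ∃ c : Fin n → ℂ, order (∑ j, c j • f j) = (k i : ℕ∞) := by
    obtain ⟨c₀, c, hc⟩ : k i ∈ vanishingOrders f := hf.2 ▸ Or.inr ⟨i, rfl⟩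
    have hc₀ : c₀ = 0 := by simpa [hf.1] using constantCoeff_eq_zero_of_order (hpos i) hc
    exact ⟨c, by simpa [hc₀] using hc⟩
  choose B hB using hex
  have hdet : (Matrix.of B).det ≠ 0 :=
    det_ne_zero_of_linearIndependent_sum_smul (linearIndependent_of_order hk hB)
  refine ⟨fun i => ∑ j, B i j • f j, (Matrix.of B)⁻¹, ?_, hB, ?_⟩
  · exact (Matrix.isUnit_nonsing_inv_det _ hdet.isUnit).ne_zero
  · funext i
    exact (sum_inv_smul_sum_smul hdet.isUnit f i).symm

theorem HasRamificationProfile.exists_valueSemigroup_eq_orderMonoid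
    (hf : HasRamificationProfile f k) (hk : Function.Injective k) (hpos : ∀ i, 0 < k i) :
    ∃ h : Fin n → ℂ⟦X⟧, (∀ i, order (h i) = (k i : ℕ∞)) ∧
      valueSemigroup f = orderMonoid (Algebra.adjoin ℂ (Set.range h)) := by
  obtain ⟨h, A, hA, ho, rfl⟩ := hf.exists_order_eq hk hpos
  refine ⟨h, ho, ?_⟩
  rw [valueSemigroup_eq_orderMonoid hf.1, ← Algebra.adjoin_span,
    span_range_sum_smul_eq hA.isUnit, Algebra.adjoin_span]

/-- The germ with parameters `p`: the entries `p (inl (i, j))` of a matrix are applied to the series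
whose `j`-th member has coefficients `p (inr (j, l))` in the degrees `l ≥ k j`. -/
noncomputable def profileGerm (k : Fin n → ℕ) (p : (Fin n × Fin n) ⊕ (Fin n × ℕ) → ℂ) :
    Fin n → ℂ⟦X⟧ :=
  fun i => ∑ j, p (.inl (i, j)) • mk fun l => if l < k j then 0 else p (.inr (j, l))

theorem hasRamificationProfile_profileGerm (hk : Function.Injective k) (hpos : ∀ i, 0 < k i)
    {p : (Fin n × Fin n) ⊕ (Fin n × ℕ) → ℂ}
    (hdet : (Matrix.of fun i j => p (.inl (i, j))).det ≠ 0) (hp : ∀ j, p (.inr (j, k j)) ≠ 0) :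
    HasRamificationProfile (profileGerm k p) k := by
  refine (hasRamificationProfile_of_order hk hpos fun j => ?_).sum_smul hdet
  exact order_eq_nat.2 ⟨by simpa using hp j, fun l hl => by simp [hl]⟩

theorem HasRamificationProfile.exists_profileGerm_eq (hf : HasRamificationProfile f k)
    (hk : Function.Injective k) (hpos : ∀ i, 0 < k i) :
    ∃ p, (Matrix.of fun i j => p (.inl (i, j))).det ≠ 0 ∧ (∀ j, p (.inr (j, k j)) ≠ 0) ∧
      profileGerm k p = f := by
  obtain ⟨h, A, hA, ho, rfl⟩ := hf.exists_order_eq hk hpos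
  refine ⟨Sum.elim (fun ij => A ij.1 ij.2) fun jl => coeff jl.2 (h jl.1), hA,
    fun j => (order_eq_nat.1 (ho j)).1, ?_⟩
  have hmk (j : Fin n) : (mk fun l => if l < k j then 0 else coeff l (h j)) = h j := by
    ext l
    rw [coeff_mk]
    split_ifs with hl
    · exact ((order_eq_nat.1 (ho j)).2 l hl).symm
    · rfl
  funext i
  exact Finset.sum_congr rfl fun j _ => congrArg (A i j • ·) (hmk j)

theorem exists_eval_eq_evalCoeffs_profileGerm (k : Fin n → ℕ)
    (Q : MvPolynomial (Fin n × ℕ) ℂ) :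
    ∃ R : MvPolynomial ((Fin n × Fin n) ⊕ (Fin n × ℕ)) ℂ,
      ∀ p, MvPolynomial.eval p R = evalCoeffs Q (profileGerm k p) := by
  refine ⟨MvPolynomial.bind₁ (fun il => ∑ j, MvPolynomial.X (.inl (il.1, j)) *
    if il.2 < k j then 0 else MvPolynomial.X (.inr (j, il.2))) Q, fun p => ?_⟩
  rw [evalCoeffs, ← MvPolynomial.coe_aeval_eq_eval, ← MvPolynomial.coe_aeval_eq_eval]
  change MvPolynomial.aeval p _ = MvPolynomial.aeval _ Q
  rw [MvPolynomial.aeval_bind₁]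
  congr 2
  funext il
  simp [profileGerm, apply_ite (MvPolynomial.eval p)]

theorem exists_eval_ne_zero_iff_profile (k : Fin n → ℕ) :
    ∃ R : MvPolynomial ((Fin n × Fin n) ⊕ (Fin n × ℕ)) ℂ, ∀ p, MvPolynomial.eval p R ≠ 0 ↔
      (Matrix.of fun i j => p (.inl (i, j))).det ≠ 0 ∧ ∀ j, p (.inr (j, k j)) ≠ 0 := by
  refine ⟨(Matrix.of fun i j => MvPolynomial.X (.inl (i, j))).det *
    ∏ j, MvPolynomial.X (.inr (j, k j)), fun p => ?_⟩
  have hmap : (MvPolynomial.eval p).mapMatrix (Matrix.of fun i j => MvPolynomial.X (.inl (i, j))) =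
      Matrix.of fun i j => p (.inl (i, j)) := by
    ext i j
    simp
  rw [map_mul, RingHom.map_det, hmap, map_prod, mul_ne_zero_iff, Finset.prod_ne_zero_iff]
  simp

-- The germs with profile `k` are parameterized by a nonempty open subset of an affine space, and
-- are therefore irreducible.
theorem exists_evalCoeffs_mul_ne_zero (hk : Function.Injective k) (hpos : ∀ i, 0 < k i)
    {Q₁ Q₂ : MvPolynomial (Fin n × ℕ) ℂ}
    (h₁ : ∃ f, HasRamificationProfile f k ∧ evalCoeffs Q₁ f ≠ 0)
    (h₂ : ∃ f, HasRamificationProfile f k ∧ evalCoeffs Q₂ f ≠ 0) :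
    ∃ f, HasRamificationProfile f k ∧ evalCoeffs (Q₁ * Q₂) f ≠ 0 := by
  obtain ⟨R, hR⟩ := exists_eval_ne_zero_iff_profile k
  have hne {Q : MvPolynomial (Fin n × ℕ) ℂ} {T : MvPolynomial ((Fin n × Fin n) ⊕ (Fin n × ℕ)) ℂ}
      (hT : ∀ p, MvPolynomial.eval p T = evalCoeffs Q (profileGerm k p))
      (h : ∃ f, HasRamificationProfile f k ∧ evalCoeffs Q f ≠ 0) : T ≠ 0 := by
    obtain ⟨f, hf, hQ⟩ := h
    obtain ⟨p, -, -, rfl⟩ := hf.exists_profileGerm_eq hk hpos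
    rintro rfl
    exact hQ (by rw [← hT, map_zero])
  have hR0 : R ≠ 0 := by
    obtain ⟨f, hf, -⟩ := h₁
    obtain ⟨p, hdet, hp, -⟩ := hf.exists_profileGerm_eq hk hpos
    rintro rfl
    exact (hR p).2 ⟨hdet, hp⟩ (map_zero _)
  obtain ⟨T₁, hT₁⟩ := exists_eval_eq_evalCoeffs_profileGerm k Q₁
  obtain ⟨T₂, hT₂⟩ := exists_eval_eq_evalCoeffs_profileGerm k Q₂
  obtain ⟨p, hp⟩ : ∃ p, MvPolynomial.eval p (R * (T₁ * T₂)) ≠ 0 := by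
    by_contra! hall
    exact mul_ne_zero hR0 (mul_ne_zero (hne hT₁ h₁) (hne hT₂ h₂))
      (MvPolynomial.funext fun p => by rw [hall p, map_zero])
  rw [map_mul, map_mul, hT₁, hT₂] at hp
  obtain ⟨hdet, hpivot⟩ := (hR p).1 (left_ne_zero_of_mul hp)
  refine ⟨profileGerm k p, hasRamificationProfile_profileGerm hk hpos hdet hpivot, ?_⟩
  rw [evalCoeffs, map_mul]
  exact right_ne_zero_of_mul hp

end Profiles

section Genericity

open PowerSeries Filter

variable {n : ℕ} {k : Fin n → ℕ}

theorem hasRamificationProfile_X_pow (hk : Function.Injective k) (hpos : ∀ i, 0 < k i) :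
    HasRamificationProfile (fun i => X ^ k i) k :=
  hasRamificationProfile_of_order hk hpos fun i => order_X_pow (k i)

/-- The filter of the sets that contain a nonempty Zariski open set of germs with profile `k`, so
that `∀ᶠ f in genericGerms hk hpos, p f` says that a generic germ with profile `k` satisfies `p`. -/
def genericGerms (hk : Function.Injective k) (hpos : ∀ i, 0 < k i) : Filter (Fin n → ℂ⟦X⟧) where
  sets := {U | ∃ Q, (∃ f, HasRamificationProfile f k ∧ evalCoeffs Q f ≠ 0) ∧
    ∀ f, HasRamificationProfile f k → evalCoeffs Q f ≠ 0 → f ∈ U}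
  univ_sets := ⟨1, ⟨_, hasRamificationProfile_X_pow hk hpos, by simp [evalCoeffs]⟩,
    fun _ _ _ => trivial⟩
  sets_of_superset := fun ⟨Q, hQ, hU⟩ hUV => ⟨Q, hQ, fun f hf hfQ => hUV (hU f hf hfQ)⟩
  inter_sets := by
    rintro U V ⟨Q₁, h₁, hU⟩ ⟨Q₂, h₂, hV⟩
    refine ⟨Q₁ * Q₂, exists_evalCoeffs_mul_ne_zero hk hpos h₁ h₂, fun f hf hQ => ?_⟩
    rw [evalCoeffs, map_mul] at hQ
    exact ⟨hU f hf (left_ne_zero_of_mul hQ), hV f hf (right_ne_zero_of_mul hQ)⟩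

variable {hk : Function.Injective k} {hpos : ∀ i, 0 < k i}

instance neBot_genericGerms : NeBot (genericGerms hk hpos) :=
  neBot_iff.2 fun h => by
    obtain ⟨Q, ⟨f, hf, hQ⟩, hQ'⟩ := empty_mem_iff_bot.2 h
    exact hQ' f hf hQ

theorem isGenericValueSemigroup_iff_eventually {S : Set ℕ} :
    IsGenericValueSemigroup k S ↔ ∀ᶠ f in genericGerms hk hpos, valueSemigroup f = S :=
  Iff.rfl

theorem eventually_hasRamificationProfile :
    ∀ᶠ f in genericGerms hk hpos, HasRamificationProfile f k :=
  ⟨1, ⟨_, hasRamificationProfile_X_pow hk hpos, by simp [evalCoeffs]⟩, fun _ hf _ => hf⟩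

/-- The coefficient of `t ^ l` in `P(f)`, as a polynomial in the coefficients of `f`. -/
noncomputable def coeffPoly (P : MvPolynomial (Fin n) ℂ) (l : ℕ) : MvPolynomial (Fin n × ℕ) ℂ :=
  coeff l (MvPolynomial.eval₂ (C.comp MvPolynomial.C)
    (fun i => mk fun j => MvPolynomial.X (i, j)) P)

theorem evalCoeffs_coeffPoly (P : MvPolynomial (Fin n) ℂ) (l : ℕ) (f : Fin n → ℂ⟦X⟧) :
    evalCoeffs (coeffPoly P l) f = coeff l (MvPolynomial.aeval f P) := by
  rw [evalCoeffs, coeffPoly, ← coeff_map, MvPolynomial.hom_eval₂, MvPolynomial.aeval_def]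
  congr 2
  · ext c
    simp
  · funext i
    ext j
    simp

open Classical in
theorem card_le_count_valueSemigroup {f : Fin n → ℂ⟦X⟧} (hf : ∀ i, constantCoeff (f i) = 0)
    {N : ℕ} {T : Type*} [Fintype T] [DecidableEq T] {s : T → ℕ} (hs : ∀ i, s i < N)
    {P : T → MvPolynomial (Fin n) ℂ}
    (hdet : (Matrix.of fun i j => coeff (s j) (MvPolynomial.aeval f (P i))).det ≠ 0) :
    Fintype.card T ≤ Nat.count (· ∈ valueSemigroup f) N := by
  have hli : LinearIndependent ℂ fun i => jet N (MvPolynomial.aeval f (P i)) :=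
    .of_comp (LinearMap.funLeft ℂ ℂ fun j => ⟨s j, hs j⟩) <|
      Matrix.linearIndependent_rows_of_det_ne_zero hdet
  rw [valueSemigroup_eq_orderMonoid hf]
  simp only [SetLike.mem_coe]
  change _ ≤ Nat.count (· ∈ orderSet _) N
  rw [count_orderSet, ← finrank_span_eq_card hli]
  refine Submodule.finrank_mono (Submodule.span_le.2 (Set.range_subset_iff.2 fun i => ?_))
  refine Submodule.mem_map_of_mem ?_
  rw [Algebra.adjoin_range_eq_range_aeval]
  exact ⟨P i, rfl⟩

open Classical in
theorem eventually_count_valueSemigroup_le {f₀ : Fin n → ℂ⟦X⟧} (hf₀ : HasRamificationProfile f₀ k)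
    (N : ℕ) : ∀ᶠ f in genericGerms hk hpos,
      Nat.count (· ∈ valueSemigroup f₀) N ≤ Nat.count (· ∈ valueSemigroup f) N := by
  let _ := Nat.CountSet.fintype (· ∈ valueSemigroup f₀) N
  let T := {s // s < N ∧ s ∈ valueSemigroup f₀}
  choose P hP using fun s : T => (mem_valueSemigroup_iff hf₀.1).1 s.2.2
  have hdet (f : Fin n → ℂ⟦X⟧) :
      evalCoeffs (Matrix.of fun i j : T => coeffPoly (P i) j).det f =
        (Matrix.of fun i j : T => coeff (j : ℕ) (MvPolynomial.aeval f (P i))).det := by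
    rw [evalCoeffs, RingHom.map_det]
    congr 1
    ext i j
    exact evalCoeffs_coeffPoly _ _ _
  refine ⟨(Matrix.of fun i j : T => coeffPoly (P i) j).det, ⟨f₀, hf₀, ?_⟩, fun f hf hQ => ?_⟩
  · have htri : (Matrix.of fun i j : T =>
        coeff (j : ℕ) (MvPolynomial.aeval f₀ (P i))).IsUpperTriangular :=
      fun i j hij => (order_eq_nat.1 (hP i)).2 _ hij
    rw [hdet, Matrix.det_of_isUpperTriangular htri]
    exact Finset.prod_ne_zero_iff.2 fun i _ => (order_eq_nat.1 (hP i)).1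
  · rw [hdet] at hQ
    rw [Set.mem_ofPred_eq, Nat.count_eq_card_fintype]
    exact card_le_count_valueSemigroup hf.1 (fun i => i.2.1) hQ

open Classical in
theorem exists_eventually_count_valueSemigroup_eq (hk : Function.Injective k)
    (hpos : ∀ i, 0 < k i) (N : ℕ) :
    ∃ M, ∀ᶠ f in genericGerms hk hpos, Nat.count (· ∈ valueSemigroup f) N = M := by
  have hbdd : ((fun f : Fin n → ℂ⟦X⟧ => Nat.count (· ∈ valueSemigroup f) N) ''
      {f | HasRamificationProfile f k}).Finite :=
    (Set.finite_Iic N).subset (Set.image_subset_iff.2 fun f _ => Nat.count_le _)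
  obtain ⟨f₀, hf₀, hmax⟩ := hbdd.exists_maximalFor' _ _ ⟨_, hasRamificationProfile_X_pow hk hpos⟩
  refine ⟨Nat.count (· ∈ valueSemigroup f₀) N, ?_⟩
  filter_upwards [eventually_hasRamificationProfile, eventually_count_valueSemigroup_le hf₀ N]
    with f hf hle
  exact (hmax hf hle).antisymm hle

open Classical in
theorem mem_iff_count_succ_ne_count {S : Set ℕ} {x : ℕ} :
    x ∈ S ↔ Nat.count (· ∈ S) (x + 1) ≠ Nat.count (· ∈ S) x := by
  rw [Nat.count_succ]
  by_cases hx : x ∈ S <;> simp [hx]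

open Classical in
theorem two_mul_count_le_of_notMem {S : AddSubmonoid ℕ} {x : ℕ} (hx : x ∉ S) :
    2 * Nat.count (· ∈ S) (x + 1) ≤ x + 1 := by
  have hreflect : ((Finset.range (x + 1)).filter (· ∈ S)).card ≤
      ((Finset.range (x + 1)).filter (· ∉ S)).card := by
    refine Finset.card_le_card_of_injOn (x - ·) (fun y hy => ?_) fun y hy z hz hyz => ?_
    · simp only [Finset.coe_filter, Finset.mem_range, Set.mem_ofPred_eq] at hy ⊢
      refine ⟨by omega, fun hxy => hx ?_⟩
      rw [← Nat.add_sub_cancel' (Nat.lt_succ_iff.1 hy.1)]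
      exact S.add_mem hy.2 hxy
    · simp only [Finset.coe_filter, Finset.mem_range, Set.mem_ofPred_eq] at hy hz hyz
      omega
  have hsplit := Finset.card_filter_add_card_filter_not (s := Finset.range (x + 1)) (· ∈ S)
  rw [Finset.card_range] at hsplit
  rw [Nat.count_eq_card_filter_range]
  omega

open Classical in
theorem mem_of_two_mul_gaps_le {S : AddSubmonoid ℕ} {δ N : ℕ} (hN : N ≤ Nat.count (· ∈ S) N + δ)
    (hδ : 4 * δ + 1 < N) {x : ℕ} (hx : 2 * δ ≤ x) : x ∈ S := by
  have hbelow (y : ℕ) (hy : 2 * δ ≤ y) (hyN : y < N) : y ∈ S := by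
    by_contra hyS
    have htwo := two_mul_count_le_of_notMem hyS
    have hadd := Nat.count_add (· ∈ S) (y + 1) (N - (y + 1))
    have hle : Nat.count (fun z => y + 1 + z ∈ S) (N - (y + 1)) ≤ _ := Nat.count_le _
    rw [Nat.add_sub_cancel' hyN] at hadd
    omega
  induction x using Nat.strong_induction_on with
  | _ x ih =>
    rcases lt_or_ge x N with hxN | hxN
    · exact hbelow x hx hxN
    · rw [← Nat.add_sub_cancel' (show 2 * δ + 1 ≤ x by omega)]
      exact S.add_mem (hbelow _ (by omega) (by omega)) (ih _ (by omega) (by omega))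

theorem exists_eventually_valueSemigroup_eq {f₀ : Fin n → ℂ⟦X⟧}
    (hf₀ : HasRamificationProfile f₀ k) (hfin : (valueSemigroup f₀)ᶜ.Finite) :
    ∃ S : Set ℕ, Sᶜ.Finite ∧ ∀ᶠ f in genericGerms hk hpos, valueSemigroup f = S := by
  classical
  obtain ⟨N, hN⟩ : ∃ N, N = 4 * (valueSemigroup f₀)ᶜ.ncard + 2 := ⟨_, rfl⟩
  choose M hM using exists_eventually_count_valueSemigroup_eq hk hpos
  have hgen : ∀ᶠ f in genericGerms hk hpos,
      (∀ s ∈ Set.Iic N, Nat.count (· ∈ valueSemigroup f) s = M s) ∧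
        ∀ x, 2 * (valueSemigroup f₀)ᶜ.ncard ≤ x → x ∈ valueSemigroup f := by
    filter_upwards [(eventually_all_finite (Set.finite_Iic N)).2 fun s _ => hM s,
      eventually_hasRamificationProfile, eventually_count_valueSemigroup_le hf₀ N]
      with f hcount hf hle
    refine ⟨hcount, fun x hx => ?_⟩
    have hgaps := (le_count_add_ncard_compl hfin N).trans (Nat.add_le_add_right hle _)
    rw [valueSemigroup_eq_orderMonoid hf.1] at hgaps ⊢
    exact mem_of_two_mul_gaps_le hgaps (by omega) hx
  obtain ⟨f₁, hcount₁, hlarge₁⟩ := hgen.exists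
  refine ⟨valueSemigroup f₁, (Set.finite_Iio (2 * (valueSemigroup f₀)ᶜ.ncard)).subset ?_, ?_⟩
  · exact fun x hx => not_le.1 fun h => hx (hlarge₁ x h)
  · filter_upwards [hgen] with f ⟨hcount, hlarge⟩
    ext x
    rcases lt_or_ge x N with hx | hx
    · rw [mem_iff_count_succ_ne_count, mem_iff_count_succ_ne_count (S := valueSemigroup f₁),
        hcount _ hx.le, hcount₁ _ hx.le, hcount _ hx, hcount₁ _ hx]
    · exact iff_of_true (hlarge x (by omega)) (hlarge₁ x (by omega))

theorem isGenericValueSemigroup_iff_eq {S T : Set ℕ}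
    (hS : ∀ᶠ f in genericGerms hk hpos, valueSemigroup f = S) :
    IsGenericValueSemigroup k T ↔ T = S := by
  rw [isGenericValueSemigroup_iff_eventually (hk := hk) (hpos := hpos)]
  constructor
  · intro hT
    obtain ⟨f, hfT, hfS⟩ := (hT.and hS).exists
    exact hfT.symm.trans hfS
  · rintro rfl
    exact hS

end Genericity

section EvenProfile

open PowerSeries

variable {n m : ℕ}

theorem strictMono_evenProfile : StrictMono (evenProfile n m) := fun i j hij => by
  simp only [evenProfile]
  omega

theorem evenProfile_pos (hm : 0 < m) (i : Fin n) : 0 < evenProfile n m i := by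
  simp only [evenProfile]
  omega

/-- The monomial germ `(t^(2m), t^(2m+2), …)`, with its second member multiplied by `1 + t`. -/
noncomputable def oddGerm (n m : ℕ) : Fin n → ℂ⟦X⟧ :=
  fun i => X ^ evenProfile n m i * (1 + if (i : ℕ) = 1 then X else 0)

theorem order_oddGerm (i : Fin n) : order (oddGerm n m i) = (evenProfile n m i : ℕ∞) := by
  rw [oddGerm, order_mul, order_X_pow, (order_eq_nat (n := 0)).2 ⟨?_, by simp⟩]
  · simp
  · split_ifs <;> simp

theorem finite_compl_valueSemigroup_oddGerm (hn : 3 ≤ n) (hm : 0 < m) :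
    (valueSemigroup (oddGerm n m))ᶜ.Finite := by
  have hf : ∀ i, constantCoeff (oddGerm n m i) = 0 := fun i =>
    constantCoeff_eq_zero_of_order (evenProfile_pos hm i) (order_oddGerm i)
  rw [valueSemigroup_eq_orderMonoid hf]
  have hgen (i : Fin n) : oddGerm n m i ∈ Algebra.adjoin ℂ (Set.range (oddGerm n m)) :=
    Algebra.subset_adjoin ⟨i, rfl⟩
  have hodd : 4 * m + 5 ∈ orderMonoid (Algebra.adjoin ℂ (Set.range (oddGerm n m))) := by
    refine mem_orderMonoid.2 ⟨_, sub_mem (mul_mem (hgen ⟨0, by omega⟩) (hgen ⟨2, by omega⟩))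
      (pow_mem (hgen ⟨1, by omega⟩) 2), ?_⟩
    have hfactor : oddGerm n m ⟨0, by omega⟩ * oddGerm n m ⟨2, by omega⟩ -
        oddGerm n m ⟨1, by omega⟩ ^ 2 = X ^ (4 * m + 5) * (C (-2) - X) := by
      simp only [oddGerm, evenProfile, map_neg, map_ofNat]
      norm_num
      ring
    rw [hfactor, order_mul, order_X_pow, (order_eq_nat (n := 0)).2 ⟨by simp, by simp⟩]
    simp
  refine finite_compl_of_setGcd_eq_one (Nat.dvd_one.1 ?_)
  have hprofile (i : Fin n) :
      evenProfile n m i ∈ (orderMonoid (Algebra.adjoin ℂ (Set.range (oddGerm n m))) : Set ℕ) :=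
    ⟨_, hgen i, order_oddGerm i⟩
  have h₀ := Nat.setGcd_dvd_of_mem (hprofile ⟨0, by omega⟩)
  have h₁ := Nat.setGcd_dvd_of_mem (hprofile ⟨1, by omega⟩)
  have h₂ := Nat.setGcd_dvd_of_mem (SetLike.mem_coe.2 hodd)
  simp only [evenProfile, mul_zero, add_zero, mul_one] at h₀ h₁
  have htwo := (Nat.dvd_add_right h₀).1 h₁
  rw [show 4 * m + 5 = 2 * (2 * m + 2) + 1 by ring] at h₂
  exact (Nat.dvd_add_right (htwo.mul_right _)).1 h₂

end EvenProfile

section Codimension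

open MvPolynomial

variable {σ : Type} [Finite σ]

theorem exists_minimalPrimes_span_of_vanishing (s : Set (MvPolynomial σ ℂ))
    {h : MvPolynomial σ ℂ} {a₀ : σ → ℂ} (ha₀ : ∀ p ∈ s, eval a₀ p = 0) (hh : eval a₀ h ≠ 0)
    {Y : Set (σ → ℂ)} (hY : ∀ a, (∀ p ∈ s, eval a p = 0) → eval a h ≠ 0 →
      ∀ H ∈ vanishingIdeal ℂ Y, eval a H = 0) :
    ∃ P ∈ (Ideal.span s).minimalPrimes, vanishingIdeal ℂ Y ≤ P := by
  have : (RingHom.ker (eval a₀)).IsPrime := RingHom.ker_isPrime _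
  have hle : Ideal.span s ≤ RingHom.ker (eval a₀) := Ideal.span_le.2 ha₀
  obtain ⟨P, hP, hPle⟩ := Ideal.exists_minimalPrimes_le hle
  have hPprime : P.IsPrime := hP.1.1
  refine ⟨P, hP, fun H hH => ?_⟩
  have hmem : h * H ∈ vanishingIdeal ℂ (zeroLocus ℂ (Ideal.span s)) := by
    refine mem_vanishingIdeal_iff.2 fun a ha => ?_
    rw [aeval_eq_eval, map_mul, mul_eq_zero, or_iff_not_imp_left]
    intro h0
    refine hY a (fun p hp => ?_) h0 H hH
    rw [← aeval_eq_eval]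
    exact mem_zeroLocus_iff.1 ha p (Ideal.subset_span hp)
  rw [vanishingIdeal_zeroLocus_eq_radical] at hmem
  exact (hPprime.mem_or_mem ((hPprime.radical_le_iff.2 hP.1.2) hmem)).resolve_left
    fun hhP => hh (hPle hhP)

theorem codimension_le_card {X Y : Set (σ → ℂ)} (hYX : Y ⊆ X)
    (s : Finset (MvPolynomial σ ℂ)) {h : MvPolynomial σ ℂ} {a₀ : σ → ℂ}
    (ha₀ : ∀ p ∈ s, eval a₀ p = 0) (hh : eval a₀ h ≠ 0)
    (hY : ∀ a, (∀ p ∈ s, eval a p = 0) → eval a h ≠ 0 →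
      ∀ H ∈ vanishingIdeal ℂ Y, eval a H = 0) :
    codimension X Y ≤ s.card := by
  classical
  obtain ⟨P, hP, hYP⟩ := exists_minimalPrimes_span_of_vanishing (s : Set _) ha₀ hh hY
  set φ := Ideal.Quotient.mk (vanishingIdeal ℂ X)
  have hker : RingHom.ker φ ≤ P :=
    Ideal.mk_ker.trans_le ((vanishingIdeal_anti_mono hYX).trans hYP)
  have hmin : P.map φ ∈ (Ideal.span (s.image φ : Set _)).minimalPrimes := by
    rw [Finset.coe_image, ← Ideal.map_span,
      Ideal.minimalPrimes_map_of_surjective Ideal.Quotient.mk_surjective]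
    exact ⟨P, ⟨⟨hP.1.1, sup_le hP.1.2 hker⟩, fun Q hQ hQP =>
      hP.2 ⟨hQ.1, le_sup_left.trans hQ.2⟩ hQP⟩, rfl⟩
  calc codimension X Y ≤ (P.map φ).height := Ideal.height_mono (Ideal.map_mono hYP)
    _ ≤ (s.image φ).card := Ideal.height_le_card_of_mem_minimalPrimes_span_finset hmin
    _ ≤ s.card := by exact_mod_cast Finset.card_image_le

end Codimension

section AlgebraicIndependence

open MvPolynomial

theorem exists_algebraicIndependent_of_countable (K : Subfield ℂ) [Countable K] (τ : Type)
    [Countable τ] : ∃ x : τ → ℂ, AlgebraicIndependent K x := by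
  obtain ⟨ι, b, hb⟩ := exists_isTranscendenceBasis' K ℂ
  have hcard := IsAlgClosed.cardinal_eq_cardinal_transcendence_basis_of_aleph0_lt' b hb
    Cardinal.mk_le_aleph0 (by rw [Cardinal.mk_complex]; exact Cardinal.aleph0_lt_continuum)
  have : Infinite ι := by
    rw [Cardinal.infinite_iff, ← hcard, Cardinal.mk_complex]
    exact Cardinal.aleph0_le_continuum
  obtain ⟨e, he⟩ := exists_injective_nat τ
  exact ⟨_, hb.1.comp _ ((Infinite.natEmbedding ι).injective.comp he)⟩

theorem eval_ne_zero_of_algebraicIndependent {K : Subfield ℂ} {τ : Type} {x : τ → ℂ}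
    (hx : AlgebraicIndependent K x) {H : MvPolynomial τ ℂ} (hH : H ≠ 0)
    (hHK : ∀ e, H.coeff e ∈ K) : eval x H ≠ 0 := by
  obtain ⟨H', rfl⟩ : H ∈ Set.range (map (algebraMap K ℂ)) := by
    rw [mem_range_map_iff_coeffs_subset]
    intro c hc
    obtain ⟨e, -, rfl⟩ := mem_coeffs_iff.1 hc
    exact ⟨⟨_, hHK e⟩, rfl⟩
  intro h0
  rw [eval_map, ← aeval_def] at h0
  exact hH (by rw [hx.eq_zero_of_aeval_eq_zero _ h0, map_zero])

theorem exists_algebraicIndependent_eval_ne_zero {τ : Type} [Countable τ]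
    {H : MvPolynomial τ ℂ} (hH : H ≠ 0) {Z : Set ℂ} (hZ : Z.Countable) :
    ∃ K : Subfield ℂ, Z ⊆ K ∧ ∃ x : τ → ℂ, AlgebraicIndependent K x ∧ eval x H ≠ 0 := by
  set C : Set ℂ := Z ∪ Set.range fun e => H.coeff e
  have hC : C.Countable := hZ.union (Set.countable_range _)
  have : Countable (Subfield.closure C) := Cardinal.mk_le_aleph0_iff.1 <|
    (Subfield.cardinalMk_closure_le_max _).trans (max_le hC.le_aleph0 le_rfl)
  obtain ⟨x, hx⟩ := exists_algebraicIndependent_of_countable (Subfield.closure C) τ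
  exact ⟨_, Set.subset_union_left.trans Subfield.subset_closure, x, hx,
    eval_ne_zero_of_algebraicIndependent hx hH fun e =>
      Subfield.subset_closure (Or.inr ⟨e, rfl⟩)⟩

variable {K L : Type*} [Field K] [Field L] [Algebra K L]

theorem card_le_card_of_isAlgebraic_adjoin {ι κ : Type*} [Fintype ι] [Fintype κ] {x : ι → L}
    (hx : AlgebraicIndependent K x) (y : κ → L)
    (h : ∀ i, IsAlgebraic (Algebra.adjoin K (Set.range y)) (x i)) :
    Fintype.card ι ≤ Fintype.card κ := by
  have hsub : Set.range x ⊆ (AlgebraicIndependent.matroid K L).closure (Set.range y) := by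
    rw [AlgebraicIndependent.matroid_closure_eq]
    rintro _ ⟨i, rfl⟩
    exact h i
  have hind : (AlgebraicIndependent.matroid K L).Indep (Set.range x) :=
    AlgebraicIndependent.matroid_indep_iff.2 hx.coe_range
  have hle := hind.encard_le_eRk_of_subset hsub
  rw [Matroid.eRk_closure_eq] at hle
  have hencard := hle.trans (Matroid.eRk_le_encard _ _)
  rw [← Set.image_univ, ← Set.image_univ, hx.injective.encard_image] at hencard
  simpa [Set.encard_univ] using hencard.trans (Set.encard_image_le _ _)

-- Otherwise one of the `x (i, j)` could be eliminated for every `i`, and `x` would have smaller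
-- transcendence degree than its number of entries.
theorem eq_zero_of_linear_relation {ι J κ : Type*} [Fintype ι] [Fintype J] [Fintype κ]
    (hcard : Fintype.card κ < Fintype.card ι) {x : ι × J → L} (hx : AlgebraicIndependent K x)
    (y : κ → L) {α : ι → L} {β : J → L} (hα : ∀ i, α i ∈ Algebra.adjoin K (Set.range y))
    (hβ : ∀ j, β j ∈ Algebra.adjoin K (Set.range y))
    (hrel : ∀ i, α i + ∑ j, β j * x (i, j) = 0) (j : J) : β j = 0 := by
  classical
  by_contra hj
  let g : κ ⊕ ι × {l : J // l ≠ j} → L := Sum.elim y fun p => x (p.1, p.2)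
  let A := Algebra.adjoin K (Set.range g)
  have hle : Algebra.adjoin K (Set.range y) ≤ A := by
    refine Algebra.adjoin_mono ?_
    rintro _ ⟨l, rfl⟩
    exact ⟨Sum.inl l, rfl⟩
  have hxA : ∀ i, ∀ l ≠ j, x (i, l) ∈ A := fun i l hl =>
    Algebra.subset_adjoin ⟨Sum.inr (i, ⟨l, hl⟩), rfl⟩
  have halg : ∀ z ∈ A, IsAlgebraic A z := fun z hz => isAlgebraic_algebraMap (⟨z, hz⟩ : A)
  have hxalg : ∀ p, IsAlgebraic A (x p) := by
    rintro ⟨i, l⟩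
    rcases eq_or_ne l j with rfl | hl
    · have hrel_i := hrel i
      rw [← Finset.add_sum_erase _ _ (Finset.mem_univ l)] at hrel_i
      have hsolve : x (i, l) = -(α i + ∑ l' ∈ Finset.univ.erase l, β l' * x (i, l')) * (β l)⁻¹ := by
        field_simp
        linear_combination hrel_i
      rw [hsolve]
      refine (halg _ (neg_mem (add_mem (hle (hα i)) (sum_mem fun l' hl' => ?_)))).mul
        (halg _ (hle (hβ l))).inv
      exact mul_mem (hle (hβ l')) (hxA i l' (Finset.ne_of_mem_erase hl'))
    · exact halg _ (hxA i l hl)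
  have hle_card := card_le_card_of_isAlgebraic_adjoin hx g hxalg
  have hJ : 0 < Fintype.card J := Fintype.card_pos_iff.2 ⟨j⟩
  simp only [Fintype.card_sum, Fintype.card_prod, Fintype.card_subtype_compl,
    Fintype.card_unique] at hle_card
  obtain ⟨c, hc⟩ := Nat.exists_eq_add_of_lt hJ
  rw [hc, Nat.zero_add, Nat.add_sub_cancel] at hle_card
  linarith

end AlgebraicIndependence

section Germs

open PowerSeries

theorem valueSemigroup_eq_univ {n : ℕ} {f : Fin n → ℂ⟦X⟧} (hf : ∀ i, constantCoeff (f i) = 0)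
    {i : Fin n} (hi : coeff 1 (f i) ≠ 0) : valueSemigroup f = Set.univ := by
  rw [valueSemigroup_eq_orderMonoid hf, ← AddSubmonoid.coe_top, SetLike.coe_set_eq]
  have hone : 1 ∈ orderMonoid (Algebra.adjoin ℂ (Set.range f)) := by
    refine mem_orderMonoid.2 ⟨f i, Algebra.subset_adjoin ⟨i, rfl⟩, order_eq_nat.2 ⟨hi, ?_⟩⟩
    intro j hj
    rw [Nat.lt_one_iff.1 hj, coeff_zero_eq_constantCoeff_apply, hf]
  rwa [eq_top_iff, ← Nat.addSubmonoidClosure_one, AddSubmonoid.closure_le,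
    Set.singleton_subset_iff]

theorem constantCoeff_affineGerm {n : ℕ} (F : Fin (n + 1) → ℂ⟦X⟧) (j : Fin (n + 1)) (i : Fin n) :
    constantCoeff (affineGerm F j i) = 0 := by
  simp [affineGerm]

theorem constantCoeff_expansion {n d : ℕ} (a : Coeffs n d) (u w : Fin 2 → ℂ) (i : Fin (n + 1)) :
    constantCoeff (expansion a u w i) = formEval a u i := by
  simp [expansion, formEval, map_sum, constantCoeff_smul]

theorem exists_coeff_one_affineGerm_ne_zero {n : ℕ} {F : Fin (n + 1) → ℂ⟦X⟧} {j : Fin (n + 1)}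
    (hj : constantCoeff (F j) ≠ 0)
    (h : ∀ μ : ℂ, ∃ i, coeff 1 (F i) ≠ μ * constantCoeff (F i)) :
    ∃ i, coeff 1 (affineGerm F j i) ≠ 0 := by
  obtain ⟨i, hi⟩ := h (coeff 1 (F j) / constantCoeff (F j))
  obtain ⟨l, rfl⟩ : ∃ l, j.succAbove l = i := by
    refine Fin.exists_succAbove_eq ?_
    rintro rfl
    exact hi (div_mul_cancel₀ _ hj).symm
  refine ⟨l, fun h0 => hi ?_⟩
  set q := F (j.succAbove l) * (F j)⁻¹ with hq
  have hq1 : coeff 1 q = 0 := by simpa [affineGerm, ← hq, coeff_C] using h0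
  have hF : F (j.succAbove l) = q * F j := by
    rw [hq, mul_assoc, PowerSeries.inv_mul_cancel _ hj, mul_one]
  clear_value q
  rw [hF, coeff_one_mul, hq1, map_mul]
  field_simp
  simp

end Germs

theorem eq_mk_one_or_eq_mk_zero_one (P : Projectivization ℂ (Fin 2 → ℂ)) :
    (∃ y : ℂ, ∃ h : (![1, y] : Fin 2 → ℂ) ≠ 0, P = Projectivization.mk ℂ ![1, y] h) ∨
      ∃ h : (![0, 1] : Fin 2 → ℂ) ≠ 0, P = Projectivization.mk ℂ ![0, 1] h := by
  induction P using Projectivization.ind with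
  | h v hv =>
    by_cases h0 : v 0 = 0
    · refine Or.inr ⟨fun h => by simpa using congrFun h 1, ?_⟩
      rw [Projectivization.mk_eq_mk_iff']
      exact ⟨v 1, by ext l; fin_cases l <;> simp [h0]⟩
    · refine Or.inl ⟨v 1 / v 0, fun h => by simpa using congrFun h 0, ?_⟩
      rw [Projectivization.mk_eq_mk_iff']
      exact ⟨v 0, by ext l; fin_cases l <;> simp [mul_div_cancel₀ _ h0]⟩

theorem formEval_zero_one {n d : ℕ} (a : Coeffs n d) (i : Fin (n + 1)) :
    formEval a (![0, 1] : Fin 2 → ℂ) i = a (i, 0) := by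
  simp [formEval, Fin.sum_univ_succ]

/-- The coefficients of the `x ^ j y ^ (d - j)` with `N ≤ j` are algebraically independent over a
field `K` that contains all the other coefficients. -/
structure IsGenericOver {n d : ℕ} (K : Subfield ℂ) (N : ℕ) (a : Coeffs n d) : Prop where
  indep : AlgebraicIndependent K
    fun p : Fin (n + 1) × {j : Fin (d + 1) // N ≤ (j : ℕ)} => a (p.1, p.2)
  mem : ∀ i (j : Fin (d + 1)), (j : ℕ) < N → a (i, j) ∈ K

namespace IsGenericOver

variable {n d N : ℕ} {K : Subfield ℂ} {a : Coeffs n d}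

theorem eq_zero_of_sum_mul_eq_zero (ha : IsGenericOver K N a) (hn : 3 ≤ n) (y : Fin 3 → ℂ)
    {z : Fin (d + 1) → ℂ} (hz : ∀ j, z j ∈ Algebra.adjoin K (Set.range y))
    (hsum : ∀ i, ∑ j, a (i, j) * z j = 0) (j : Fin (d + 1)) (hj : N ≤ (j : ℕ)) : z j = 0 := by
  refine eq_zero_of_linear_relation (by simpa using hn) ha.indep y
    (α := fun i => ∑ j : {j : Fin (d + 1) // ¬ N ≤ (j : ℕ)}, a (i, j) * z j)
    (β := fun j => z j) (fun i => sum_mem fun j _ => mul_mem ?_ (hz j)) (fun j => hz j)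
    (fun i => ?_) ⟨j, hj⟩
  · exact Subalgebra.algebraMap_mem _ (⟨_, ha.mem i j (not_le.1 j.2)⟩ : K)
  · rw [← hsum i, ← Fintype.sum_subtype_add_sum_subtype (fun j : Fin (d + 1) => N ≤ (j : ℕ)),
      add_comm]
    exact congrArg (· + _) (Finset.sum_congr rfl fun _ _ => mul_comm _ _)

theorem monomial_eq_of_formEval_eq_smul (ha : IsGenericOver K N a) (hn : 3 ≤ n) (y : Fin 3 → ℂ)
    {u v : Fin 2 → ℂ} {c : ℂ} (hu : ∀ l, u l ∈ Algebra.adjoin K (Set.range y))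
    (hv : ∀ l, v l ∈ Algebra.adjoin K (Set.range y)) (hc : c ∈ Algebra.adjoin K (Set.range y))
    (h : formEval a u = c • formEval a v) {j : ℕ} (hj : N ≤ j) (hjd : j ≤ d) :
    u 0 ^ j * u 1 ^ (d - j) = c * (v 0 ^ j * v 1 ^ (d - j)) := by
  refine sub_eq_zero.1 (ha.eq_zero_of_sum_mul_eq_zero hn y
    (z := fun j => u 0 ^ (j : ℕ) * u 1 ^ (d - j) - c * (v 0 ^ (j : ℕ) * v 1 ^ (d - j)))
    (fun j => ?_) (fun i => ?_) ⟨j, by omega⟩ hj)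
  · exact sub_mem (mul_mem (pow_mem (hu 0) _) (pow_mem (hu 1) _))
      (mul_mem hc (mul_mem (pow_mem (hv 0) _) (pow_mem (hv 1) _)))
  · have hi := congrFun h i
    simp only [formEval, Pi.smul_apply, smul_eq_mul, Finset.mul_sum] at hi
    simp only [mul_sub, Finset.sum_sub_distrib, hi, sub_eq_zero]
    exact Finset.sum_congr rfl fun _ _ => by ring

theorem basePointFree (ha : IsGenericOver K N a) (hn : 3 ≤ n) (hd : N < d) {i : Fin (n + 1)}
    (hi : a (i, 0) ≠ 0) : BasePointFree a := by
  intro u hu hzero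
  have hmem : ∀ l, u l ∈ Algebra.adjoin K (Set.range ![u 0, u 1, 0]) := fun l =>
    Algebra.subset_adjoin (by fin_cases l <;> simp)
  have hu0 : u 0 = 0 := by
    have := ha.monomial_eq_of_formEval_eq_smul hn _ hmem hmem (zero_mem _)
      (by rw [hzero, zero_smul]) hd.le le_rfl
    simp only [Nat.sub_self, pow_zero, mul_one, zero_mul] at this
    exact eq_zero_of_pow_eq_zero this
  have hu01 : u = u 1 • ![0, 1] := by
    ext l
    fin_cases l <;> simp [hu0]
  have hu1 : u 1 ≠ 0 := fun h => hu (by rw [hu01, h, zero_smul])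
  have hform := congrFun hzero i
  rw [hu01, formEval_smul, Pi.smul_apply, formEval_zero_one, smul_eq_mul] at hform
  exact mul_ne_zero (pow_ne_zero _ hu1) hi hform

theorem formEval_ne_smul_formEval_zero_one (ha : IsGenericOver K N a) (hn : 3 ≤ n) (hd : N < d)
    (y c : ℂ) : formEval a ![1, y] ≠ c • formEval a ![0, 1] := by
  intro h
  have := ha.monomial_eq_of_formEval_eq_smul hn ![y, c, 0]
    (Fin.forall_fin_two.2 ⟨one_mem _, Algebra.subset_adjoin (by simp)⟩)
    (Fin.forall_fin_two.2 ⟨zero_mem _, one_mem _⟩) (Algebra.subset_adjoin (by simp)) h hd.le le_rfl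
  simp [(Nat.zero_lt_of_lt hd).ne'] at this

theorem eq_of_formEval_eq_smul (ha : IsGenericOver K N a) (hn : 3 ≤ n) (hd : N < d) {y y' c : ℂ}
    (h : formEval a ![1, y] = c • formEval a ![1, y']) : y = y' := by
  have key := fun j => ha.monomial_eq_of_formEval_eq_smul hn ![y, y', c]
    (Fin.forall_fin_two.2 ⟨one_mem _, Algebra.subset_adjoin (by simp)⟩)
    (Fin.forall_fin_two.2 ⟨one_mem _, Algebra.subset_adjoin (by simp)⟩)
    (Algebra.subset_adjoin (by simp)) h (j := j)
  have hc : c = 1 := by simpa using (key d hd.le le_rfl).symm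
  have hy := key (d - 1) (Nat.le_sub_one_of_lt hd) (Nat.sub_le d 1)
  rw [Nat.sub_sub_self (Nat.one_le_of_lt hd)] at hy
  simpa [hc] using hy

theorem injective (ha : IsGenericOver K N a) (hn : 3 ≤ n) (hd : N < d) (hbpf : BasePointFree a) :
    Function.Injective (toProjMap a hbpf) := by
  intro P Q hPQ
  rcases eq_mk_one_or_eq_mk_zero_one P with ⟨y, hy, rfl⟩ | ⟨hp, rfl⟩ <;>
    rcases eq_mk_one_or_eq_mk_zero_one Q with ⟨y', hy', rfl⟩ | ⟨hq, rfl⟩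
  · obtain ⟨c, hc⟩ := (Projectivization.mk_eq_mk_iff' ℂ _ _ _ _).1 hPQ
    obtain rfl := ha.eq_of_formEval_eq_smul hn hd hc.symm
    rfl
  · obtain ⟨c, hc⟩ := (Projectivization.mk_eq_mk_iff' ℂ _ _ _ _).1 hPQ
    exact absurd hc.symm (ha.formEval_ne_smul_formEval_zero_one hn hd y c)
  · obtain ⟨c, hc⟩ := (Projectivization.mk_eq_mk_iff' ℂ _ _ _ _).1 hPQ.symm
    exact absurd hc.symm (ha.formEval_ne_smul_formEval_zero_one hn hd y' c)
  · rfl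

theorem exists_coeff_one_expansion_ne (ha : IsGenericOver K N a) (hn : 3 ≤ n) (hd : N < d)
    (y μ : ℂ) : ∃ i, PowerSeries.coeff 1 (expansion a ![1, y] ![0, 1] i) ≠
      μ * PowerSeries.constantCoeff (expansion a ![1, y] ![0, 1] i) := by
  by_contra! h
  have hy : y ∈ Algebra.adjoin K (Set.range ![y, μ, 0]) := Algebra.subset_adjoin (by simp)
  have hμ : μ ∈ Algebra.adjoin K (Set.range ![y, μ, 0]) := Algebra.subset_adjoin (by simp)
  have key := ha.eq_zero_of_sum_mul_eq_zero hn ![y, μ, 0]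
    (z := fun j => ((d - j : ℕ) : ℂ) * y ^ (d - j - 1) - μ * y ^ (d - j))
    (fun j => sub_mem (mul_mem (natCast_mem _ _) (pow_mem hy _)) (mul_mem hμ (pow_mem hy _)))
    (fun i => by
      have hi := h i
      rw [constantCoeff_expansion] at hi
      simp only [expansion, formEval, Matrix.cons_val_zero, Matrix.cons_val_one, zero_smul,
        add_zero, map_one, one_pow, one_mul, one_smul, map_sum, PowerSeries.coeff_smul,
        PowerSeries.coeff_one_pow, map_add, PowerSeries.coeff_C, PowerSeries.coeff_one_X,
        PowerSeries.constantCoeff_C, PowerSeries.constantCoeff_X, one_ne_zero, if_false, zero_add,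
        mul_one, smul_eq_mul, Finset.mul_sum] at hi
      simp only [mul_sub, Finset.sum_sub_distrib, hi, sub_eq_zero]
      exact Finset.sum_congr rfl fun _ _ => by ring)
  have hμ0 : μ = 0 := by simpa using key (Fin.last d) hd.le
  have hone := key ⟨d - 1, by omega⟩ (Nat.le_sub_one_of_lt hd)
  simp [Nat.sub_sub_self (Nat.one_le_of_lt hd), hμ0] at hone

theorem hasValueSemigroupAt_univ (ha : IsGenericOver K N a) (hn : 3 ≤ n) (hd : N < d)
    (hbpf : BasePointFree a) (y : ℂ) (h : (![1, y] : Fin 2 → ℂ) ≠ 0) :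
    HasValueSemigroupAt a (Projectivization.mk ℂ ![1, y] h) Set.univ := by
  obtain ⟨j, hj⟩ := Function.ne_iff.1 (hbpf _ h)
  have hindep : LinearIndependent ℂ ![![1, y], ![0, 1]] :=
    LinearIndependent.pair_iff.2 fun s t hst => by
      have h0 : s = 0 := by simpa using congrFun hst 0
      exact ⟨h0, by simpa [h0] using congrFun hst 1⟩
  obtain ⟨i, hi⟩ := exists_coeff_one_affineGerm_ne_zero
    (by rwa [constantCoeff_expansion]) (ha.exists_coeff_one_expansion_ne hn hd y)
  exact ⟨![1, y], ![0, 1], h, j, rfl, hindep, hj,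
    valueSemigroup_eq_univ (constantCoeff_affineGerm _ _) hi⟩

end IsGenericOver

section RowReduction

open PowerSeries

variable {N : ℕ} {R R' : Type*} [CommRing R] [CommRing R']

/-- The matrix of the coefficients of `t ^ (k c)`, `c < i`, in the series `F`, completed by the
unit vectors `e_c`, `c ≥ i`, to a square matrix. -/
noncomputable def pivotMatrix (k : Fin N → ℕ) (F : Fin N → R⟦X⟧) (i : Fin N) :
    Matrix (Fin N) (Fin N) R :=
  Matrix.of fun r c => if c < i then coeff (k c) (F r) else (1 : Matrix (Fin N) (Fin N) R) r c

/-- The combination of `F 0, …, F i` obtained by eliminating the coefficients of `t ^ (k c)`,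
`c < i`, without division: its coefficients are minors of the matrix of coefficients of `F`. -/
noncomputable def rowReduction (k : Fin N → ℕ) (F : Fin N → R⟦X⟧) (i : Fin N) : R⟦X⟧ :=
  ∑ r, (pivotMatrix k F i).adjugate i r • F r

/-- The product of the minors that have to be invertible for the row reduction of `F` with pivots
in the columns `k` to succeed. -/
noncomputable def pivotProd (k : Fin N → ℕ) (F : Fin N → R⟦X⟧) : R :=
  ∏ i, (pivotMatrix k F i).det * coeff (k i) (rowReduction k F i)

variable (k : Fin N → ℕ) (F : Fin N → R⟦X⟧)

theorem map_pivotMatrix (φ : R →+* R') (i : Fin N) :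
    φ.mapMatrix (pivotMatrix k F i) = pivotMatrix k (fun r => map φ (F r)) i := by
  ext r c
  simp only [pivotMatrix, RingHom.mapMatrix_apply, Matrix.map_apply, Matrix.of_apply,
    Matrix.one_apply, coeff_map]
  split_ifs <;> simp

theorem map_rowReduction (φ : R →+* R') (i : Fin N) :
    map φ (rowReduction k F i) = rowReduction k (fun r => map φ (F r)) i := by
  have hadj := φ.map_adjugate (pivotMatrix k F i)
  rw [map_pivotMatrix] at hadj
  simp only [rowReduction, map_sum, smul_eq_C_mul, map_mul, map_C, ← hadj,
    RingHom.mapMatrix_apply, Matrix.map_apply]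

theorem map_pivotProd (φ : R →+* R') :
    φ (pivotProd k F) = pivotProd k fun r => map φ (F r) := by
  simp only [pivotProd, map_prod, map_mul, RingHom.map_det, map_pivotMatrix, ← map_rowReduction,
    coeff_map]

theorem coeff_rowReduction (i : Fin N) (j : ℕ) :
    coeff j (rowReduction k F i) = ∑ r, (pivotMatrix k F i).adjugate i r * coeff j (F r) := by
  simp [rowReduction]

theorem coeff_pivot_rowReduction {i c : Fin N} (hc : c < i) :
    coeff (k c) (rowReduction k F i) = 0 := by
  have h := congrFun₂ (Matrix.adjugate_mul (pivotMatrix k F i)) i c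
  rw [Matrix.mul_apply, Matrix.smul_apply, Matrix.one_apply_ne hc.ne', smul_zero] at h
  rw [coeff_rowReduction, ← h]
  simp [pivotMatrix, hc]

theorem adjugate_pivotMatrix {i r : Fin N} (hir : i ≤ r) :
    (pivotMatrix k F i).adjugate i r =
      (pivotMatrix k F i).det * (1 : Matrix (Fin N) (Fin N) R) i r := by
  have h := congrFun₂ (Matrix.adjugate_mul (pivotMatrix k F i)) i r
  rw [Matrix.mul_apply, Matrix.smul_apply, smul_eq_mul] at h
  rw [← h]
  simp [pivotMatrix, hir.not_gt, Matrix.one_apply]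

variable {k F}

theorem pivotProd_eq_one (hF : ∀ r c, coeff (k c) (F r) = if r = c then 1 else 0) :
    pivotProd k F = 1 := by
  have hone : ∀ i, pivotMatrix k F i = 1 := fun i => by
    ext r c
    simp [pivotMatrix, hF, Matrix.one_apply]
  simp [pivotProd, coeff_rowReduction, hone, hF, Matrix.one_apply]

section Congr

variable {F' : Fin N → R⟦X⟧} {d : ℕ}

theorem pivotMatrix_congr (hk : ∀ i, k i < d)
    (hF : ∀ r, ∀ l < d, coeff l (F r) = coeff l (F' r)) (i : Fin N) :
    pivotMatrix k F i = pivotMatrix k F' i := by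
  ext r c
  simp only [pivotMatrix, Matrix.of_apply, hF r _ (hk c)]

theorem coeff_rowReduction_congr (hk : ∀ i, k i < d)
    (hF : ∀ r, ∀ l < d, coeff l (F r) = coeff l (F' r)) (i : Fin N) {j : ℕ}
    (hj : j < d) :
    coeff j (rowReduction k F i) = coeff j (rowReduction k F' i) := by
  simp only [coeff_rowReduction, pivotMatrix_congr hk hF, hF _ j hj]

theorem pivotProd_congr (hk : ∀ i, k i < d)
    (hF : ∀ r, ∀ l < d, coeff l (F r) = coeff l (F' r)) :
    pivotProd k F = pivotProd k F' :=
  Finset.prod_congr rfl fun i _ => by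
    rw [pivotMatrix_congr hk hF, coeff_rowReduction_congr hk hF i (hk i)]

theorem X_pow_dvd_rowReduction_congr (hk : ∀ i, k i < d)
    (hF : ∀ r, ∀ l < d, coeff l (F r) = coeff l (F' r)) (i : Fin N) :
    X ^ k i ∣ rowReduction k F i ↔ X ^ k i ∣ rowReduction k F' i := by
  simp only [X_pow_dvd_iff]
  exact forall₂_congr fun j hj => by rw [coeff_rowReduction_congr hk hF i (hj.trans (hk i))]

end Congr

end RowReduction

section Field

open PowerSeries

variable {N : ℕ} {𝕜 : Type*} [Field 𝕜] {k : Fin N → ℕ} {F : Fin N → 𝕜⟦X⟧}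

theorem span_range_rowReduction (hF : pivotProd k F ≠ 0) :
    Submodule.span 𝕜 (Set.range (rowReduction k F)) = Submodule.span 𝕜 (Set.range F) := by
  refine span_range_sum_smul_eq (A := Matrix.of fun i r => (pivotMatrix k F i).adjugate i r) ?_ F
  rw [isUnit_iff_ne_zero, Matrix.det_of_isLowerTriangular]
  · refine Finset.prod_ne_zero_iff.2 fun i hi => ?_
    rw [Matrix.of_apply, adjugate_pivotMatrix _ _ le_rfl, Matrix.one_apply_eq, mul_one]
    exact left_ne_zero_of_mul (Finset.prod_ne_zero_iff.1 hF i hi)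
  · intro i r hir
    have hlt : i < r := hir
    rw [Matrix.of_apply, adjugate_pivotMatrix _ _ hlt.le, Matrix.one_apply_ne hlt.ne, mul_zero]

theorem order_rowReduction (hF : pivotProd k F ≠ 0) {i : Fin N}
    (hdvd : X ^ k i ∣ rowReduction k F i) : order (rowReduction k F i) = k i :=
  order_eq_nat.2 ⟨right_ne_zero_of_mul (Finset.prod_ne_zero_iff.1 hF i (Finset.mem_univ i)),
    X_pow_dvd_iff.1 hdvd⟩

theorem orderSet_span_range_of_X_pow_dvd (hk : Function.Injective k) (hF : pivotProd k F ≠ 0)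
    (hdvd : ∀ i, X ^ k i ∣ rowReduction k F i) :
    orderSet (Submodule.span 𝕜 (Set.range F)) = Set.range k := by
  rw [← span_range_rowReduction hF]
  exact orderSet_span_range hk fun i => order_rowReduction hF (hdvd i)

theorem linearIndependent_of_X_pow_dvd (hk : Function.Injective k) (hF : pivotProd k F ≠ 0)
    (hdvd : ∀ i, X ^ k i ∣ rowReduction k F i) : LinearIndependent 𝕜 F := by
  have hli := linearIndependent_of_order hk fun i => order_rowReduction hF (hdvd i)
  rw [linearIndependent_iff_card_eq_finrank_span, Set.finrank] at hli ⊢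
  rwa [← span_range_rowReduction hF]

theorem X_pow_dvd_rowReduction (hk : StrictMono k)
    (hF : orderSet (Submodule.span 𝕜 (Set.range F)) = Set.range k) (i : Fin N) :
    X ^ k i ∣ rowReduction k F i := by
  rw [X_pow_dvd_iff]
  intro j hj
  by_cases htop : order (rowReduction k F i) = ⊤
  · rw [order_eq_top.1 htop, map_zero]
  obtain ⟨s, hs⟩ := ENat.ne_top_iff_exists.1 htop
  have hmem : s ∈ orderSet (Submodule.span 𝕜 (Set.range F)) :=
    ⟨_, sum_mem fun r _ => Submodule.smul_mem _ _ (Submodule.subset_span ⟨r, rfl⟩), hs.symm⟩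
  rw [hF] at hmem
  obtain ⟨c, rfl⟩ := hmem
  have hord := order_eq_nat.1 hs.symm
  rcases lt_or_ge c i with hc | hc
  · exact absurd (coeff_pivot_rowReduction k F hc) hord.1
  · exact hord.2 j (hj.trans_le (hk.monotone hc))

end Field

section Chart

open PowerSeries

theorem orderSet_subset_of_le_comap_mulRight {𝕜 : Type*} [Field 𝕜] {W W' : Submodule 𝕜 𝕜⟦X⟧}
    {u : 𝕜⟦X⟧} (hu : constantCoeff u ≠ 0) (h : W ≤ W'.comap (LinearMap.mulRight 𝕜 u)) :
    orderSet W ⊆ orderSet W' := by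
  rintro s ⟨w, hw, hs⟩
  refine ⟨w * u, h hw, ?_⟩
  rw [order_mul, hs, order_zero_of_unit ((isUnit_iff_constantCoeff).2 hu.isUnit), add_zero]

theorem vanishingOrders_affineGerm {n : ℕ} {F : Fin (n + 1) → ℂ⟦X⟧}
    (h₀ : constantCoeff (F 0) ≠ 0) :
    vanishingOrders (affineGerm F 0) = orderSet (Submodule.span ℂ (Set.range F)) := by
  have hC (c : ℂ) : C c = c • (1 : ℂ⟦X⟧) := by rw [smul_eq_C_mul, mul_one]
  have hone : (1 : ℂ⟦X⟧) ∈ Submodule.span ℂ (insert 1 (Set.range (affineGerm F 0))) :=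
    Submodule.subset_span (Set.mem_insert _ _)
  rw [vanishingOrders_eq_orderSet]
  refine (orderSet_subset_of_le_comap_mulRight h₀ (Submodule.span_le.2 ?_)).antisymm
    (orderSet_subset_of_le_comap_mulRight (u := (F 0)⁻¹) (by simpa using h₀)
      (Submodule.span_le.2 ?_))
  · rintro _ (rfl | ⟨i, rfl⟩)
    · simpa using Submodule.subset_span (Set.mem_range_self 0)
    · have hi : affineGerm F 0 i * F 0 =
          F i.succ - constantCoeff (F i.succ * (F 0)⁻¹) • F 0 := by
        rw [affineGerm, Fin.zero_succAbove, sub_mul, mul_assoc, PowerSeries.inv_mul_cancel _ h₀,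
          mul_one, ← smul_eq_C_mul]
      rw [SetLike.mem_coe, Submodule.mem_comap, LinearMap.mulRight_apply, hi]
      exact sub_mem (Submodule.subset_span ⟨_, rfl⟩)
        (Submodule.smul_mem _ _ (Submodule.subset_span ⟨_, rfl⟩))
  · rintro _ ⟨i, rfl⟩
    rw [SetLike.mem_coe, Submodule.mem_comap, LinearMap.mulRight_apply]
    induction i using Fin.cases with
    | zero => rwa [PowerSeries.mul_inv_cancel _ h₀]
    | succ i =>
      have hi : F i.succ * (F 0)⁻¹ = affineGerm F 0 i +
          constantCoeff (F i.succ * (F 0)⁻¹) • (1 : ℂ⟦X⟧) := by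
        rw [affineGerm, Fin.zero_succAbove, ← hC, sub_add_cancel]
      rw [hi]
      exact add_mem (Submodule.subset_span (Or.inr ⟨i, rfl⟩)) (Submodule.smul_mem _ _ hone)

end Chart

section Origin

variable {n d : ℕ}

/-- The homogeneous coordinates of the morphism near the point `[0 : 1]`, in the local parameter
`x / y`. Their coefficients are the coefficients of the forms. -/
noncomputable def originExpansion (a : Coeffs n d) : Fin (n + 1) → PowerSeries ℂ :=
  expansion a ![0, 1] ![1, 0]

/-- The forms with indeterminate coefficients, in the local parameter `x / y`. -/
noncomputable def universalExpansion (n d : ℕ) (r : Fin (n + 1)) :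
    PowerSeries (MvPolynomial (Fin (n + 1) × Fin (d + 1)) ℂ) :=
  PowerSeries.mk fun l => if h : l < d + 1 then MvPolynomial.X (r, ⟨l, h⟩) else 0

theorem coeff_originExpansion (a : Coeffs n d) (r : Fin (n + 1)) (l : ℕ) :
    PowerSeries.coeff l (originExpansion a r) =
      if h : l < d + 1 then a (r, ⟨l, h⟩) else 0 := by
  simp only [originExpansion, expansion, formEval, Matrix.cons_val_zero, Matrix.cons_val_one,
    map_zero, map_one, zero_add, one_smul, zero_smul, add_zero, one_pow, mul_one, map_sum,
    PowerSeries.coeff_smul, PowerSeries.coeff_X_pow, smul_eq_mul, mul_ite, mul_zero]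
  split_ifs with h
  · rw [Finset.sum_eq_single_of_mem ⟨l, h⟩ (Finset.mem_univ _), if_pos rfl]
    exact fun j _ hj => if_neg fun hl => hj (Fin.ext hl.symm)
  · exact Finset.sum_eq_zero fun j _ => if_neg (by omega)

theorem constantCoeff_originExpansion (a : Coeffs n d) (r : Fin (n + 1)) :
    PowerSeries.constantCoeff (originExpansion a r) = a (r, 0) := by
  rw [originExpansion, constantCoeff_expansion, formEval_zero_one]

theorem map_universalExpansion (a : Coeffs n d) (r : Fin (n + 1)) :
    PowerSeries.map (MvPolynomial.eval a) (universalExpansion n d r) = originExpansion a r := by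
  ext l
  rw [PowerSeries.coeff_map, universalExpansion, PowerSeries.coeff_mk, coeff_originExpansion]
  split_ifs <;> simp

theorem linearIndependent_of_originExpansion {a : Coeffs n d}
    (ha : LinearIndependent ℂ (originExpansion a)) :
    LinearIndependent ℂ fun i j => a (i, j) := by
  rw [Fintype.linearIndependent_iff] at ha ⊢
  refine fun c hc => ha c ?_
  ext l
  rw [map_sum, map_zero]
  simp only [PowerSeries.coeff_smul, coeff_originExpansion, smul_eq_mul]
  split_ifs with h
  · simpa using congrFun hc ⟨l, h⟩
  · simp

open MvPolynomial in
theorem exists_eval_eq_evalCoeffs_affineGerm_mul_pow (d : ℕ) (Q : MvPolynomial (Fin n × ℕ) ℂ) :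
    ∃ (P : MvPolynomial (Fin (n + 1) × Fin (d + 1)) ℂ) (M : ℕ), ∀ a : Coeffs n d, a (0, 0) ≠ 0 →
      eval a P = evalCoeffs Q (affineGerm (originExpansion a) 0) * a (0, 0) ^ M := by
  let R := MvPolynomial (Fin (n + 1) × Fin (d + 1)) ℂ
  -- The affine germ of the universal forms is defined over `R[1 / a₀₀]`.
  let ι := algebraMap R (Localization.Away (X (0, 0) : R))
  have hunit : IsUnit (ι (X (0, 0))) := IsLocalization.Away.algebraMap_isUnit _
  let F := fun r => PowerSeries.map ι (universalExpansion n d r)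
  let V := PowerSeries.invOfUnit (F 0) hunit.unit
  have hV : V * F 0 = 1 := PowerSeries.invOfUnit_mul _ _ (by
    simp [F, universalExpansion, ← PowerSeries.coeff_zero_eq_constantCoeff_apply])
  let G := fun i : Fin n =>
    F i.succ * V - PowerSeries.C (PowerSeries.constantCoeff (F i.succ * V))
  obtain ⟨⟨P, ⟨_, M, rfl⟩⟩, hP⟩ := IsLocalization.surj (Submonoid.powers (X (0, 0) : R))
    (eval₂ (ι.comp C) (fun v => PowerSeries.coeff v.2 (G v.1)) Q)
  refine ⟨P, M, fun a ha => ?_⟩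
  have ha' : IsUnit (eval a (X (0, 0))) := by simpa using ha
  let φ := IsLocalization.Away.lift (S := Localization.Away (X (0, 0) : R)) (X (0, 0)) ha'
  have hφ : φ.comp ι = eval a := IsLocalization.Away.lift_comp _ ha'
  have hφF (r : Fin (n + 1)) : PowerSeries.map φ (F r) = originExpansion a r := by
    rw [← map_universalExpansion, ← hφ, PowerSeries.map_comp, RingHom.comp_apply]
  have hφV : PowerSeries.map φ V = (originExpansion a 0)⁻¹ := by
    rw [PowerSeries.eq_inv_iff_mul_eq_one (by rwa [constantCoeff_originExpansion]), ← hφF,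
      ← map_mul, hV, map_one]
  have hφG (i : Fin n) : PowerSeries.map φ (G i) = affineGerm (originExpansion a) 0 i := by
    rw [map_sub, PowerSeries.map_C, ← PowerSeries.coeff_zero_eq_constantCoeff_apply,
      ← PowerSeries.coeff_map, map_mul, hφF, hφV, PowerSeries.coeff_zero_eq_constantCoeff_apply,
      affineGerm, Fin.zero_succAbove]
  have hφQ : φ (eval₂ (ι.comp C) (fun v => PowerSeries.coeff v.2 (G v.1)) Q) =
      evalCoeffs Q (affineGerm (originExpansion a) 0) := by
    have hid : (eval a).comp C = RingHom.id ℂ := RingHom.ext fun c => eval_C c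
    rw [hom_eval₂, ← RingHom.comp_assoc, hφ, hid]
    simp only [← PowerSeries.coeff_map, hφG]
    rfl
  have hφι (p : R) : φ (ι p) = eval a p := RingHom.congr_fun hφ p
  calc eval a P = φ (ι P) := (hφι P).symm
    _ = _ := by rw [← hP, map_mul, hφQ, hφι]; simp

theorem exists_eval_ne_zero_iff_evalCoeffs_affineGerm (d : ℕ) (Q : MvPolynomial (Fin n × ℕ) ℂ) :
    ∃ H : MvPolynomial (Fin (n + 1) × Fin (d + 1)) ℂ, ∀ a : Coeffs n d,
      MvPolynomial.eval a H ≠ 0 ↔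
        a (0, 0) ≠ 0 ∧ evalCoeffs Q (affineGerm (originExpansion a) 0) ≠ 0 := by
  obtain ⟨P, M, hP⟩ := exists_eval_eq_evalCoeffs_affineGerm_mul_pow d Q
  refine ⟨MvPolynomial.X (0, 0) * P, fun a => ?_⟩
  rw [map_mul, MvPolynomial.eval_X, mul_ne_zero_iff]
  refine and_congr_right fun ha => ?_
  rw [hP a ha, mul_ne_zero_iff, and_iff_left (pow_ne_zero M ha)]

end Origin

section PivotEquations

variable {n d : ℕ}

/-- The equations, where `pivotProd` is nonzero, of the space of forms of degree `d` whose vanishing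
orders at `[0 : 1]` are `k 0, …, k n`: the coefficients of the row reduction of the universal forms
that have to vanish. -/
noncomputable def pivotEquations (d : ℕ) (k : Fin (n + 1) → ℕ) :
    Finset (MvPolynomial (Fin (n + 1) × Fin (d + 1)) ℂ) :=
  open Classical in
  Finset.univ.biUnion fun i => (Finset.range (k i) \ (Finset.Iio i).image k).image fun j =>
    PowerSeries.coeff j (rowReduction k (universalExpansion n d) i)

theorem card_pivotEquations_le {k : Fin (n + 1) → ℕ} (hk : StrictMono k) :
    (pivotEquations d k).card ≤ ∑ i, (k i - i) := by
  refine Finset.card_biUnion_le.trans (Finset.sum_le_sum fun i _ => Finset.card_image_le.trans ?_)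
  have hsub : (Finset.Iio i).image k ⊆ Finset.range (k i) :=
    Finset.image_subset_iff.2 fun c hc => Finset.mem_range.2 (hk (Finset.mem_Iio.1 hc))
  rw [Finset.card_sdiff_of_subset hsub, Finset.card_range,
    Finset.card_image_of_injective _ hk.injective, Fin.card_Iio]

theorem eval_coeff_rowReduction_universalExpansion (k : Fin (n + 1) → ℕ) (a : Coeffs n d)
    (i : Fin (n + 1)) (j : ℕ) :
    MvPolynomial.eval a (PowerSeries.coeff j (rowReduction k (universalExpansion n d) i)) =
      PowerSeries.coeff j (rowReduction k (originExpansion a) i) := by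
  rw [← PowerSeries.coeff_map, map_rowReduction]
  simp only [map_universalExpansion]

theorem forall_mem_pivotEquations_eval_eq_zero_iff (k : Fin (n + 1) → ℕ) (a : Coeffs n d) :
    (∀ p ∈ pivotEquations d k, MvPolynomial.eval a p = 0) ↔
      ∀ i, PowerSeries.X ^ k i ∣ rowReduction k (originExpansion a) i := by
  simp only [pivotEquations, Finset.mem_biUnion, Finset.mem_univ, true_and, forall_exists_index,
    PowerSeries.X_pow_dvd_iff]
  rw [forall_comm]
  refine forall_congr' fun i => ?_
  simp only [Finset.forall_mem_image, eval_coeff_rowReduction_universalExpansion]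
  refine ⟨fun h j hj => ?_, fun h j hj => h j (by simp_all)⟩
  by_cases hc : j ∈ (Finset.Iio i).image k
  · obtain ⟨c, hci, rfl⟩ := Finset.mem_image.1 hc
    exact coeff_pivot_rowReduction k _ (Finset.mem_Iio.1 hci)
  · exact h (Finset.mem_sdiff.2 ⟨Finset.mem_range.2 hj, hc⟩)

theorem exists_eval_ne_zero_iff_pivotProd_and_evalCoeffs (d : ℕ) (k : Fin (n + 1) → ℕ)
    (Q : MvPolynomial (Fin n × ℕ) ℂ) :
    ∃ H : MvPolynomial (Fin (n + 1) × Fin (d + 1)) ℂ, ∀ a, MvPolynomial.eval a H ≠ 0 ↔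
      pivotProd k (originExpansion a) ≠ 0 ∧ a (0, 0) ≠ 0 ∧
        evalCoeffs Q (affineGerm (originExpansion a) 0) ≠ 0 := by
  obtain ⟨P, hP⟩ := exists_eval_ne_zero_iff_evalCoeffs_affineGerm d Q
  refine ⟨pivotProd k (universalExpansion n d) * P, fun a => ?_⟩
  rw [map_mul, mul_ne_zero_iff, hP, map_pivotProd]
  simp only [map_universalExpansion]

end PivotEquations

section CuspForms

open PowerSeries

variable {n : ℕ} {k : Fin n → ℕ}

theorem eventually_pivotProd_ne_zero {hk : Function.Injective k} {hpos : ∀ i, 0 < k i} :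
    ∀ᶠ f in genericGerms hk hpos,
      pivotProd (Fin.cons 0 k) (Fin.cons 1 f : Fin (n + 1) → ℂ⟦X⟧) ≠ 0 := by
  let U : Fin (n + 1) → (MvPolynomial (Fin n × ℕ) ℂ)⟦X⟧ :=
    Fin.cons 1 fun i => mk fun l => MvPolynomial.X (i, l)
  have hU (f : Fin n → ℂ⟦X⟧) : evalCoeffs (pivotProd (Fin.cons 0 k) U) f =
      pivotProd (Fin.cons 0 k) (Fin.cons 1 f : Fin (n + 1) → ℂ⟦X⟧) := by
    rw [evalCoeffs, map_pivotProd]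
    congr 1
    funext r
    induction r using Fin.cases with
    | zero => simp [U]
    | succ i => ext l; simp [U]
  refine ⟨pivotProd (Fin.cons 0 k) U, ⟨_, hasRamificationProfile_X_pow hk hpos, ?_⟩,
    fun f _ hf => by rwa [hU] at hf⟩
  rw [hU, pivotProd_eq_one fun r c => ?_]
  · exact one_ne_zero
  have h0 : (Fin.cons 1 fun i => X ^ k i : Fin (n + 1) → ℂ⟦X⟧) =
      fun r => X ^ (Fin.cons 0 k : Fin (n + 1) → ℕ) r := by
    funext r
    induction r using Fin.cases <;> simp
  have hinj := cons_zero_injective hk hpos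
  rw [h0, coeff_X_pow]
  simp only [hinj.eq_iff, eq_comm]

/-- The forms of degree `d` with affine coordinates `f`, up to terms of order greater than `d`. -/
noncomputable def truncatedForms (d : ℕ) (f : Fin n → ℂ⟦X⟧) : Coeffs n d :=
  fun v => coeff (v.2 : ℕ) ((Fin.cons 1 f : Fin (n + 1) → ℂ⟦X⟧) v.1)

variable {d : ℕ} {f : Fin n → ℂ⟦X⟧}

theorem coeff_originExpansion_truncatedForms (r : Fin (n + 1)) {l : ℕ} (hl : l < d + 1) :
    coeff l (originExpansion (truncatedForms d f) r) =
      coeff l ((Fin.cons 1 f : Fin (n + 1) → ℂ⟦X⟧) r) := by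
  rw [coeff_originExpansion, dif_pos hl, truncatedForms]

theorem evalCoeffs_affineGerm_truncatedForms {Q : MvPolynomial (Fin n × ℕ) ℂ}
    (hQ : ∀ v ∈ Q.vars, v.2 ≤ d) (hf : ∀ i, constantCoeff (f i) = 0) :
    evalCoeffs Q (affineGerm (originExpansion (truncatedForms d f)) 0) = evalCoeffs Q f := by
  have hone : originExpansion (truncatedForms d f) 0 = 1 := by
    ext l
    rw [coeff_originExpansion]
    split_ifs with hl
    · simp [truncatedForms]
    · rw [coeff_one, if_neg (by omega)]
  refine MvPolynomial.eval₂Hom_congr' rfl (fun v hv _ => ?_) rfl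
  have hconst : constantCoeff (originExpansion (truncatedForms d f) v.1.succ) = 0 := by
    simpa [constantCoeff_originExpansion, truncatedForms] using hf v.1
  have hcoeff := coeff_originExpansion_truncatedForms (f := f) v.1.succ
    (Nat.lt_succ_of_le (hQ v hv))
  rw [Fin.cons_succ] at hcoeff
  rw [← hcoeff]
  simp [affineGerm, hone, hconst]

theorem HasRamificationProfile.X_pow_dvd_rowReduction_truncatedForms
    (hf : HasRamificationProfile f k) (hk : StrictMono k) (hpos : ∀ i, 0 < k i)
    (hd : ∀ i, (Fin.cons 0 k : Fin (n + 1) → ℕ) i < d + 1) (i : Fin (n + 1)) :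
    X ^ (Fin.cons 0 k : Fin (n + 1) → ℕ) i ∣
      rowReduction (Fin.cons 0 k) (originExpansion (truncatedForms d f)) i := by
  rw [X_pow_dvd_rowReduction_congr hd
    fun r l hl => coeff_originExpansion_truncatedForms (f := f) r hl]
  refine X_pow_dvd_rowReduction (Fin.strictMono_cons.2 ⟨hpos, hk⟩) ?_ i
  rw [Fin.range_cons, Fin.range_cons, ← vanishingOrders_eq_orderSet, hf.2]

theorem hasRamificationProfile_affineGerm (hk : Function.Injective k) (hpos : ∀ i, 0 < k i)
    {F : Fin (n + 1) → ℂ⟦X⟧} (h₀ : constantCoeff (F 0) ≠ 0)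
    (hprod : pivotProd (Fin.cons 0 k) F ≠ 0)
    (hdvd : ∀ i, X ^ (Fin.cons 0 k : Fin (n + 1) → ℕ) i ∣ rowReduction (Fin.cons 0 k) F i) :
    HasRamificationProfile (affineGerm F 0) k := by
  refine ⟨constantCoeff_affineGerm F 0, ?_⟩
  rw [vanishingOrders_affineGerm h₀, orderSet_span_range_of_X_pow_dvd
    (cons_zero_injective hk hpos) hprod hdvd, Fin.range_cons]

end CuspForms

section Generic

open MvPolynomial

variable {n d N : ℕ} {A : Type*}

/-- The coefficients of index `≥ N` of the forms `a` replaced by `x`. -/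
def replaceTail (a : Fin (n + 1) × Fin (d + 1) → A)
    (x : Fin (n + 1) × {j : Fin (d + 1) // N ≤ (j : ℕ)} → A) : Fin (n + 1) × Fin (d + 1) → A :=
  fun v => if h : N ≤ (v.2 : ℕ) then x (v.1, ⟨v.2, h⟩) else a v

theorem replaceTail_self (a : Fin (n + 1) × Fin (d + 1) → A) :
    replaceTail (N := N) a (fun v => a (v.1, v.2)) = a := by
  funext v
  simp [replaceTail]

theorem eval_aeval_replaceTail (a : Coeffs n d)
    (x : Fin (n + 1) × {j : Fin (d + 1) // N ≤ (j : ℕ)} → ℂ)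
    (p : MvPolynomial (Fin (n + 1) × Fin (d + 1)) ℂ) :
    eval x (aeval (replaceTail (fun v => C (a v)) X) p) = eval (replaceTail a x) p := by
  rw [← aeval_eq_eval, ← aeval_eq_eval, comp_aeval_apply]
  congr 2
  funext v
  simp only [replaceTail]
  split_ifs <;> simp

theorem coeff_originExpansion_replaceTail (a : Coeffs n d)
    (x : Fin (n + 1) × {j : Fin (d + 1) // N ≤ (j : ℕ)} → ℂ) (r : Fin (n + 1)) {l : ℕ}
    (hl : l < N) : PowerSeries.coeff l (originExpansion (replaceTail a x) r) =
      PowerSeries.coeff l (originExpansion a r) := by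
  simp only [coeff_originExpansion, replaceTail, dif_neg hl.not_ge]

theorem isGenericOver_replaceTail {a : Coeffs n d} {K : Subfield ℂ}
    {x : Fin (n + 1) × {j : Fin (d + 1) // N ≤ (j : ℕ)} → ℂ} (hx : AlgebraicIndependent K x)
    (ha : ∀ v, a v ∈ K) : IsGenericOver K N (replaceTail a x) where
  indep := by
    convert hx with v
    simp [replaceTail, v.2.2]
  mem i j hj := by
    rw [replaceTail, dif_neg hj.not_ge]
    exact ha _

theorem eval_eq_zero_of_isGenericOver (N : ℕ) {a : Coeffs n d}
    {h H : MvPolynomial (Fin (n + 1) × Fin (d + 1)) ℂ} (hh : eval a h ≠ 0)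
    (hH : ∀ (K : Subfield ℂ) x, IsGenericOver K N (replaceTail (N := N) a x) →
      eval (replaceTail a x) h ≠ 0 → eval (replaceTail a x) H = 0) :
    eval a H = 0 := by
  by_contra hHa
  have hne : aeval (replaceTail (N := N) (fun v => C (a v)) X) (h * H) ≠ 0 := by
    intro hzero
    have heval := eval_aeval_replaceTail (N := N) a (fun v => a (v.1, v.2)) (h * H)
    rw [hzero, map_zero, replaceTail_self, map_mul] at heval
    exact mul_ne_zero hh hHa heval.symm
  obtain ⟨K, haK, x, hx, hxH⟩ :=
    exists_algebraicIndependent_eval_ne_zero hne (Set.countable_range a)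
  rw [eval_aeval_replaceTail, map_mul] at hxH
  exact right_ne_zero_of_mul hxH
    (hH K x (isGenericOver_replaceTail hx fun v => haK ⟨v, rfl⟩) (left_ne_zero_of_mul hxH))

theorem IsGenericOver.mem_severiVariety {K : Subfield ℂ} {a : Coeffs n d} {S : Set ℕ}
    (ha : IsGenericOver K N a) (hn : 3 ≤ n) (hd : N < d) (h₀ : a (0, 0) ≠ 0)
    (hli : LinearIndependent ℂ (originExpansion a)) (hne : S ≠ Set.univ)
    (hS : valueSemigroup (affineGerm (originExpansion a) 0) = S) : a ∈ severiVariety n d S := by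
  have hbpf := ha.basePointFree hn hd h₀
  have hp : (![0, 1] : Fin 2 → ℂ) ≠ 0 := fun h => by simpa using congrFun h 1
  have hindep : LinearIndependent ℂ ![![0, 1], ![(1 : ℂ), 0]] :=
    LinearIndependent.pair_iff.2 fun s t hst =>
      ⟨by simpa using congrFun hst 1, by simpa using congrFun hst 0⟩
  refine ⟨⟨hbpf, linearIndependent_of_originExpansion hli⟩, hne, hbpf, ha.injective hn hd hbpf,
    Projectivization.mk ℂ ![0, 1] hp,
    ⟨![0, 1], ![1, 0], hp, 0, rfl, hindep, by rwa [formEval_zero_one], hS⟩, fun q hq => ?_⟩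
  rcases eq_mk_one_or_eq_mk_zero_one q with ⟨y, h, rfl⟩ | ⟨h, rfl⟩
  · exact ha.hasValueSemigroupAt_univ hn hd hbpf y h
  · exact absurd rfl hq

end Generic

section SeveriCodimension

open PowerSeries Filter

variable {n d : ℕ} {k : Fin n → ℕ} {Q : MvPolynomial (Fin n × ℕ) ℂ} {S : Set ℕ}

theorem codimension_severiVariety_le (hn : 3 ≤ n) (hk : StrictMono k) (hpos : ∀ i, 0 < k i)
    (hQ : ∀ f, HasRamificationProfile f k → evalCoeffs Q f ≠ 0 → valueSemigroup f = S)
    (hne : S ≠ Set.univ) {f : Fin n → ℂ⟦X⟧} (hf : HasRamificationProfile f k)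
    (hQf : evalCoeffs Q f ≠ 0)
    (hprod : pivotProd (Fin.cons 0 k) (Fin.cons 1 f : Fin (n + 1) → ℂ⟦X⟧) ≠ 0) {N : ℕ}
    (hkN : ∀ i, (Fin.cons 0 k : Fin (n + 1) → ℕ) i < N) (hNd : N < d)
    (hQd : ∀ v ∈ Q.vars, v.2 ≤ d) :
    codimension (morphismSpace n d) (severiVariety n d S) ≤
      ((pivotEquations d (Fin.cons 0 k)).card : ℕ∞) := by
  have hkd (i) : (Fin.cons 0 k : Fin (n + 1) → ℕ) i < d + 1 := (hkN i).trans (by omega)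
  obtain ⟨H, hH⟩ := exists_eval_ne_zero_iff_pivotProd_and_evalCoeffs d (Fin.cons 0 k) Q
  have ha₀ : MvPolynomial.eval (truncatedForms d f) H ≠ 0 := by
    rw [hH, pivotProd_congr hkd fun r l hl => coeff_originExpansion_truncatedForms r hl,
      evalCoeffs_affineGerm_truncatedForms hQd hf.1]
    exact ⟨hprod, by simp [truncatedForms], hQf⟩
  refine codimension_le_card (fun a ha => ha.1) _
    ((forall_mem_pivotEquations_eval_eq_zero_iff _ _).2
      (hf.X_pow_dvd_rowReduction_truncatedForms hk hpos hkd)) ha₀ fun a ha haH P hP => ?_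
  refine eval_eq_zero_of_isGenericOver N haH fun K x hx hxH => ?_
  obtain ⟨hxprod, hx₀, hxQ⟩ := (hH _).1 hxH
  have hdvd (i) : X ^ (Fin.cons 0 k : Fin (n + 1) → ℕ) i ∣
      rowReduction (Fin.cons 0 k) (originExpansion (replaceTail a x)) i := by
    rw [X_pow_dvd_rowReduction_congr hkN
      fun r l hl => coeff_originExpansion_replaceTail a x r hl]
    exact (forall_mem_pivotEquations_eval_eq_zero_iff _ _).1 ha i
  have hprofile := hasRamificationProfile_affineGerm hk.injective hpos
    (by rwa [constantCoeff_originExpansion]) hxprod hdvd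
  rw [← MvPolynomial.aeval_eq_eval]
  exact MvPolynomial.mem_vanishingIdeal_iff.1 hP _ <| hx.mem_severiVariety hn hNd hx₀
    (linearIndependent_of_X_pow_dvd (cons_zero_injective hk.injective hpos) hxprod hdvd) hne
    (hQ _ hprofile hxQ)

theorem eventually_codimension_severiVariety_le (hn : 3 ≤ n) (hk : StrictMono k)
    (hpos : ∀ i, 0 < k i) (hS : IsGenericValueSemigroup k S) (hne : S ≠ Set.univ) :
    ∀ᶠ d in atTop, codimension (morphismSpace n d) (severiVariety n d S) ≤
      ((∑ i, (k i - (i + 1)) : ℕ) : ℕ∞) := by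
  obtain ⟨Q, hQ₀, hQ⟩ := hS
  have hQ_generic : ∀ᶠ f in genericGerms hk.injective hpos, evalCoeffs Q f ≠ 0 :=
    ⟨Q, hQ₀, fun _ _ h => h⟩
  obtain ⟨f, ⟨hf, hQf⟩, hprod⟩ := ((eventually_hasRamificationProfile.and hQ_generic).and
    eventually_pivotProd_ne_zero).exists
  obtain ⟨N, hN⟩ := (eventually_all.2 fun i => eventually_gt_atTop
    ((Fin.cons 0 k : Fin (n + 1) → ℕ) i)).exists
  have hQd : ∀ᶠ d in atTop, ∀ v ∈ Q.vars, v.2 ≤ d :=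
    (eventually_all_finset _).2 fun v _ => eventually_ge_atTop v.2
  filter_upwards [eventually_gt_atTop N, hQd] with d hNd hQd
  refine (codimension_severiVariety_le hn hk hpos hQ hne hf hQf hprod hN hNd hQd).trans ?_
  have hcard := card_pivotEquations_le (d := d) (Fin.strictMono_cons.2 ⟨hpos, hk⟩)
  rw [Fin.sum_univ_succ] at hcard
  exact Nat.cast_le.2 (by simpa using hcard)

end SeveriCodimension

section EvenProfileBounds

open PowerSeries

variable {n m : ℕ} {f : Fin n → ℂ⟦X⟧}

theorem four_mul_le_ncard_compl_valueSemigroup (hm : 0 < m)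
    (hf : HasRamificationProfile f (evenProfile n m)) (hfin : (valueSemigroup f)ᶜ.Finite) :
    4 * m ≤ (valueSemigroup f)ᶜ.ncard + (n + 1) := by
  obtain ⟨h, ho, hS⟩ := hf.exists_valueSemigroup_eq_orderMonoid strictMono_evenProfile.injective
    (evenProfile_pos hm)
  rw [hS] at hfin ⊢
  have hdvd (i : Fin n) : X ^ (2 * m) ∣ h i :=
    X_pow_dvd_of_order_eq (ho _) (by rw [evenProfile]; omega)
  have hgaps := two_mul_le_ncard_compl_orderMonoid_adjoin_add hdvd hfin
  rw [Fintype.card_fin] at hgaps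
  omega

theorem six_mul_add_two_le_ncard_compl_valueSemigroup (hn : 0 < n) (hm : 0 < m)
    (hf : HasRamificationProfile f (evenProfile n m)) (hfin : (valueSemigroup f)ᶜ.Finite) :
    6 * m + 2 ≤ (valueSemigroup f)ᶜ.ncard + ((n + 2).choose 2 + 1) := by
  obtain ⟨h, ho, hS⟩ := hf.exists_valueSemigroup_eq_orderMonoid strictMono_evenProfile.injective
    (evenProfile_pos hm)
  rw [hS] at hfin ⊢
  have hdvd₀ : X ^ (2 * m) ∣ h ⟨0, hn⟩ :=
    X_pow_dvd_of_order_eq (ho _) (by rw [evenProfile]; omega)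
  have hdvd (i : Fin n) (hi : i ≠ ⟨0, hn⟩) : X ^ (2 * m + 2) ∣ h i := by
    have hi0 : (i : ℕ) ≠ 0 := fun h0 => hi (Fin.ext h0)
    exact X_pow_dvd_of_order_eq (ho i) (by rw [evenProfile]; omega)
  have hgaps := three_mul_add_le_ncard_compl_orderMonoid_adjoin_add hdvd₀ hdvd (by omega) hfin
  rw [Fintype.card_fin] at hgaps
  omega

theorem two_mul_sum_evenProfile_sub_add (hm : 0 < m) :
    2 * ∑ i : Fin n, (evenProfile n m i - (i + 1)) + 3 * n = 4 * m * n + n ^ 2 := by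
  induction n with
  | zero => simp
  | succ n ih =>
    have hlast : evenProfile (n + 1) m (Fin.last n) - (n + 1) = 2 * m + n - 1 := by
      simp only [evenProfile, Fin.val_last]
      omega
    rw [Fin.sum_univ_castSucc, Fin.val_last, hlast]
    simp only [evenProfile, Fin.val_castSucc] at ih ⊢
    grind

theorem sum_evenProfile_sub_lt {g : ℕ} (hn : 4 ≤ n) (hm : n + 4 ≤ m) (h₁ : 4 * m ≤ g + (n + 1))
    (h₂ : 6 * m + 2 ≤ g + ((n + 2).choose 2 + 1)) :
    ∑ i : Fin n, (evenProfile n m i - (i + 1)) < (n - 2) * g := by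
  have hsum := two_mul_sum_evenProfile_sub_add (n := n) (m := m) (by omega)
  obtain rfl | rfl | hn6 : n = 4 ∨ n = 5 ∨ 6 ≤ n := by omega
  · norm_num [Nat.choose] at h₂
    omega
  · norm_num [Nat.choose] at h₂
    omega
  · obtain ⟨p, rfl⟩ := Nat.exists_eq_add_of_le hn6
    rw [show 6 + p - 2 = p + 4 by omega]
    nlinarith

open Filter in
theorem exists_generic_evenProfile (hn : 4 ≤ n) (hm : n + 4 ≤ m) :
    ∃ S : Set ℕ, (∀ T, IsGenericValueSemigroup (evenProfile n m) T ↔ T = S) ∧ Sᶜ.Finite ∧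
      n ≤ Sᶜ.ncard ∧ m ≤ Sᶜ.ncard ∧
      ∀ᶠ d in atTop, codimension (morphismSpace n d) (severiVariety n d S) <
        (((n - 2) * Sᶜ.ncard : ℕ) : ℕ∞) := by
  have hpos := evenProfile_pos (n := n) (m := m) (by omega)
  have hinj := (strictMono_evenProfile (n := n) (m := m)).injective
  obtain ⟨S, hfin, hS⟩ := exists_eventually_valueSemigroup_eq (hk := hinj) (hpos := hpos)
    (hasRamificationProfile_of_order hinj hpos order_oddGerm)
    (finite_compl_valueSemigroup_oddGerm (by omega) (by omega))
  obtain ⟨f, hf, rfl⟩ := (eventually_hasRamificationProfile.and hS).exists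
  have hgen (T) := isGenericValueSemigroup_iff_eq (T := T) hS
  have h₁ := four_mul_le_ncard_compl_valueSemigroup (by omega) hf hfin
  have h₂ := six_mul_add_two_le_ncard_compl_valueSemigroup (by omega) (by omega) hf hfin
  have hne : valueSemigroup f ≠ Set.univ := fun h => by
    rw [h, Set.compl_univ, Set.ncard_empty] at h₁
    omega
  refine ⟨_, hgen, hfin, by omega, by omega, ?_⟩
  filter_upwards [eventually_codimension_severiVariety_le (by omega) strictMono_evenProfile hpos
    ((hgen _).2 rfl) hne] with d hd
  exact hd.trans_lt (Nat.cast_lt.2 (sum_evenProfile_sub_lt hn hm h₁ h₂))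

end EvenProfileBounds

end SeveriGen

open Filter in
theorem corollary3p15_general :
    ∃ D : ℕ → ℕ, ∀ n m : ℕ, 4 ≤ n → n + 4 ≤ m →
      ∃ S : Set ℕ,
        (∀ S' : Set ℕ,
          SeveriGen.IsGenericValueSemigroup (SeveriGen.evenProfile n m) S' ↔ S' = S) ∧
        Sᶜ.Finite ∧
        ∀ g : ℕ, g = Sᶜ.ncard → ∀ d : ℕ, D g ≤ d →
          SeveriGen.codimension (SeveriGen.morphismSpace n d) (SeveriGen.severiVariety n d S) <
            (((n - 2) * g : ℕ) : ℕ∞) := by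
  choose! S hS hfin hn hm hcodim using
    fun n m => SeveriGen.exists_generic_evenProfile (n := n) (m := m)
  -- As `n` and `m` are at most `g`, only finitely many profiles compete for the bound `D g`.
  have hD (g : ℕ) : ∃ D, ∀ d ≥ D, ∀ n ∈ Set.Iic g, ∀ m ∈ Set.Iic g, 4 ≤ n → n + 4 ≤ m →
      SeveriGen.codimension (SeveriGen.morphismSpace n d) (SeveriGen.severiVariety n d (S n m)) <
        (((n - 2) * (S n m)ᶜ.ncard : ℕ) : ℕ∞) := by
    simp only [← eventually_atTop, eventually_all_finite (Set.finite_Iic g),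
      eventually_imp_distrib_left]
    exact fun n _ m _ => hcodim n m
  choose D hD using hD
  refine ⟨D, fun n m h4 h => ⟨S n m, hS n m h4 h, hfin n m h4 h, ?_⟩⟩
  rintro _ rfl d hd
  exact hD _ d hd n (hn n m h4 h) m (hm n m h4 h) h4 h

theorem corollary3p15 :
    ∃ D : ℕ → ℕ, ∀ n m : ℕ, 4 ≤ n → (7 / 6 : ℝ) * n + 26 / 9 < m →
      ∃ S : Set ℕ,
        (∀ S' : Set ℕ,
          SeveriGen.IsGenericValueSemigroup (SeveriGen.evenProfile n m) S' ↔ S' = S) ∧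
        Sᶜ.Finite ∧
        ∀ g : ℕ, g = Sᶜ.ncard → ∀ d : ℕ, D g ≤ d →
          SeveriGen.codimension (SeveriGen.morphismSpace n d) (SeveriGen.severiVariety n d S) <
            (((n - 2) * g : ℕ) : ℕ∞) := by
  obtain ⟨D, hD⟩ := corollary3p15_general
  refine ⟨D, fun n m hn hm => hD n m hn ?_⟩
  have hn' : (4 : ℝ) ≤ n := by exact_mod_cast hn
  have hlt : (n + 3 : ℝ) < m := by linarith
  exact_mod_cast hlt
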